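/- Let $K$ be a field with $\operatorname{char}K\ne 2$, $d\ge 2$, $m\ge 0$, and fix a confocal system of quadrics in $\mathbf P^d(K)$, i.e. a family whose dual quadrics form a pencil $\{sA+tB\}$ ($A,B$ linearly independent symmetric matrices); "quadric of the system" means a nondegenerate one. Let $u$ be the tangent hyperplane at a point $x$ of a quadric $\mathcal Q$ of the system, and $z$ its pole with respect to another quadric of the system, with $z\notin u$ (the line $xz$ does not depend on the choice of that quadric). Lines $\ell_1,\ell_2$ through $x$, not in $u$, obey the reflection law on $\mathcal Q$ at $x$ if they are coplanar with $xz$ and $\ell_2$ is the harmonic conjugate of $\ell_1$ with respect to $xz$ and the line $t$ in which the plane of the lines meets $u$ (with the usual convention $\ell_2=\ell_1$ if $\ell_1=xz$). Let $\mathcal A$ be the set of lines touching $d-1$ fixed quadrics of the system. A double reflection net for quadrics $\mathcal Q_1,\dots,\mathcal Q_m$ of the system is a map $\varphi:\mathbf Z^m\to\mathcal A$ together with a choice of points on the edges of $\mathbf Z^m$ such that (1) for each $j$ and $\mathbf n$ the lines $\varphi(\mathbf n)$, $\varphi(\mathbf n+\mathbf e_j)$ obey the reflection law on $\mathcal Q_j$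 at the point of the edge $(\mathbf n,\mathbf n+\mathbf e_j)$, and the points of consecutive edges of direction $\mathbf e_j$ are different (so $(\varphi(\mathbf n+k\mathbf e_j))_{k\in\mathbf Z}$ is a billiard trajectory within $\mathcal Q_j$); (2) for $i\ne j$ the lines $\varphi(\mathbf n),\varphi(\mathbf n+\mathbf e_i),\varphi(\mathbf n+\mathbf e_j),\varphi(\mathbf n+\mathbf e_i+\mathbf e_j)$ form a double reflection configuration, i.e. moreover the tangent hyperplanes of $\mathcal Q_i,\mathcal Q_j$ at the four points of the edges of this square belong to a pencil. Let $\varphi:\mathbf Z^m\to\mathcal A$ be a double reflection net for $\mathcal Q_1,\dots,\mathcal Q_m$, let $\mathcal Q_\delta$ be a quadric of the system, $\mathbf n_0\in\mathbf Z^m$, and let $\ell'$ be a line that obeys with $\varphi(\mathbf n_0)$ the reflection law on $\mathcal Q_\delta$. Call a double reflection net $\bar\varphi:\mathbf Z^{m+1}\to\mathcal A$ for $\mathcal Q_1,\dots,\mathcal Q_m,\mathcal Q_\delta$ an extension if $\bar\varphi(\mathbf n,0)=\varphi(\mathbf n)$ for all $\mathbf n\in\mathbf Z^m$ and $\bar\varphi(\mathbf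 n_0,1)=\ell'$. (a) Suppose that $\mathcal Q_1,\dots,\mathcal Q_m,\mathcal Q_\delta$ are pairwise distinct and that no reflection degenerates, i.e. whenever a line obtained from $\varphi(\mathbf n_0)$ by finitely many reflections on these quadrics meets one of them at a point $x$, the pole of the tangent hyperplane at $x$ with respect to some quadric of the system is not in that hyperplane. Then there is exactly one extension $\bar\varphi$. (b) For every extension $\bar\varphi$, the map $\varphi^+(\mathbf n)=\bar\varphi(\mathbf n,1)$ is an $F$-transformation of $\varphi$: both $\varphi$ and $\varphi^+$ are line congruences (lines at neighbouring points of $\mathbf Z^m$ meet), and $\varphi^+(\mathbf n)$ meets $\varphi(\mathbf n)$ for every $\mathbf n\in\mathbf Z^m$. -/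

import Mathlib

open Module

/-- Homogeneous coordinate vectors of the projective space `P^d` over `K`. A point of `P^d` is
represented by a nonzero vector. -/
abbrev HVec (K : Type*) (d : ℕ) := Fin (d + 1) → K

/-- Matrices of quadrics of `P^d`. -/
abbrev QMat (K : Type*) (d : ℕ) := Matrix (Fin (d + 1)) (Fin (d + 1)) K

/-- The set of lines of `P^d`, i.e. the Grassmannian `Gr(2, d+1)`. -/
abbrev PLine (K : Type*) [Field K] (d : ℕ) := {ℓ : Submodule K (HVec K d) // finrank K ℓ = 2}

section Quadrics

variable {K : Type*} [Field K] {d : ℕ}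

/-- The vector `x` represents a point of the quadric `(Q ξ, ξ) = 0`. -/
def OnQuadric (Q : QMat K d) (x : HVec K d) : Prop :=
  x ≠ 0 ∧ x ⬝ᵥ Q.mulVec x = 0

/-- The polar hyperplane of `x` with respect to the quadric with matrix `Q`; if `x` is on the
quadric, this is the tangent hyperplane at `x`. -/
def polarHyperplane (Q : QMat K d) (x : HVec K d) : Submodule K (HVec K d) where
  carrier := {v | Q.mulVec x ⬝ᵥ v = 0}
  zero_mem' := by simp
  add_mem' := by
    intro a b ha hb
    simp only [Set.mem_ofPred_eq] at ha hb ⊢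
    rw [dotProduct_add, ha, hb, add_zero]
  smul_mem' := by
    intro c a ha
    simp only [Set.mem_ofPred_eq] at ha ⊢
    rw [dotProduct_smul, ha, smul_zero]

/-- The vector `z` represents the pole, with respect to `Q₂`, of the tangent hyperplane of `Q₁`
at `x` : the hyperplanes `(Q₂ z, ·) = 0` and `(Q₁ x, ·) = 0` coincide. -/
def IsPoleOfTangent (Q₁ Q₂ : QMat K d) (x z : HVec K d) : Prop :=
  Q₂.mulVec z = Q₁.mulVec x

/-- Two matrices give the same quadric : they differ by a nonzero scalar factor. -/
def SameQuadric (Q₁ Q₂ : QMat K d) : Prop :=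
  ∃ c : K, c ≠ 0 ∧ Q₂ = c • Q₁

/-- The line `ℓ` touches the quadric `Q` : it lies in the tangent hyperplane at one of its
points. -/
def Touches (Q : QMat K d) (ℓ : PLine K d) : Prop :=
  ∃ x ∈ ℓ.1, OnQuadric Q x ∧ ℓ.1 ≤ polarHyperplane Q x

/-- Two lines of `P^d` have a common point. -/
def LinesMeet (ℓ₁ ℓ₂ : PLine K d) : Prop :=
  ∃ x : HVec K d, x ≠ 0 ∧ x ∈ ℓ₁.1 ∧ x ∈ ℓ₂.1

end Quadrics

/-- A confocal system of quadrics in `P^d`, given by the pencil of dual quadrics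
`s A + t B`, `[s : t] ∈ P^1`. -/
structure ConfocalSystem (K : Type*) [Field K] (d : ℕ) where
  A : QMat K d
  B : QMat K d
  symmA : A.IsSymm
  symmB : B.IsSymm
  indep : LinearIndependent K ![A, B]

section Reflection

variable {K : Type*} [Field K] {d : ℕ}

/-- The (nondegenerate) quadric with matrix `Q` belongs to the confocal system: its dual quadric,
which has matrix `Q⁻¹`, belongs to the pencil. -/
def ConfocalSystem.IsMember (F : ConfocalSystem K d) (Q : QMat K d) : Prop :=
  Q.IsSymm ∧ IsUnit Q.det ∧ ∃ s t : K, Q⁻¹ = s • F.A + t • F.B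

/-- For lines through the point `x` in one plane, with `n ≠ t` and `ℓ₁ ≠ t` : the line `ℓ₂` is the
harmonic conjugate of `ℓ₁` with respect to the pair `n`, `t`. For `c = 0` this is the limiting
case `ℓ₁ = ℓ₂ = n` of a fixed line of the harmonic involution. -/
def HarmonicLines (x : HVec K d) (n t ℓ₁ ℓ₂ : Submodule K (HVec K d)) : Prop :=
  ∃ (p q : HVec K d) (c : K), LinearIndependent K ![x, p, q] ∧
    n = Submodule.span K {x, p} ∧ t = Submodule.span K {x, q} ∧
    ℓ₁ = Submodule.span K {x, p + c • q} ∧ ℓ₂ = Submodule.span K {x, p - c • q}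

/-- The reflection law at the point `x` of `Q₁`, with respect to the confocal system that contains
`Q₁` and `Q₂`. Here `u = polarHyperplane Q₁ x` is the tangent hyperplane of `Q₁` at `x`, `z` is its
pole with respect to `Q₂`, and `t` is the line in which the plane of the lines meets `u`. The lines
`ℓ₁`, `ℓ₂`, `xz`, `t` are coplanar and harmonically conjugated. -/
def ReflectionLawAt (Q₁ Q₂ : QMat K d) (x : HVec K d) (ℓ₁ ℓ₂ : PLine K d) : Prop :=
  OnQuadric Q₁ x ∧ ∃ z : HVec K d, IsPoleOfTangent Q₁ Q₂ x z ∧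
    ∃ t : Submodule K (HVec K d),
      (Submodule.span K {x, z} ⊔ t) ⊓ polarHyperplane Q₁ x = t ∧
      HarmonicLines x (Submodule.span K {x, z}) t ℓ₁.1 ℓ₂.1

/-- The lines `ℓ₁`, `ℓ₂` obey the reflection law at the point `x` of the quadric `Q` with respect to
the confocal system `F`. (The line `xz` does not depend on the second quadric of `F`.) -/
def ConfocalSystem.Reflects (F : ConfocalSystem K d) (Q : QMat K d) (x : HVec K d)
    (ℓ₁ ℓ₂ : PLine K d) : Prop :=
  ∃ Q₂ : QMat K d, F.IsMember Q₂ ∧ ¬ SameQuadric Q Q₂ ∧ ReflectionLawAt Q Q₂ x ℓ₁ ℓ₂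

/-- The lines `ℓ k` form a billiard trajectory within `Q` with reflection points `x k`:
consecutive lines obey the reflection law at `x k`, and the line `ℓ (k + 1)` joins two different
points `x k` and `x (k + 1)` of the quadric. -/
def ConfocalSystem.IsBilliardTrajectory (F : ConfocalSystem K d) (Q : QMat K d)
    (ℓ : ℤ → PLine K d) (x : ℤ → HVec K d) : Prop :=
  ∀ k : ℤ, F.Reflects Q (x k) (ℓ k) (ℓ (k + 1)) ∧ LinearIndependent K ![x k, x (k + 1)]

/-- The lines `ℓ`, `ℓ₁`, `ℓ₂`, `ℓ₁₂` form a double reflection configuration with points `x₁`, `x₂`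
of `Q₁` and `y₁`, `y₂` of `Q₂` : the four reflection laws hold, and the four tangent hyperplanes at
these points belong to a pencil, i.e. they all contain one subspace of codimension two. -/
def ConfocalSystem.IsDoubleReflectionConfiguration (F : ConfocalSystem K d) (Q₁ Q₂ : QMat K d)
    (x₁ x₂ y₁ y₂ : HVec K d) (ℓ ℓ₁ ℓ₂ ℓ₁₂ : PLine K d) : Prop :=
  F.Reflects Q₁ x₁ ℓ ℓ₁ ∧ F.Reflects Q₁ x₂ ℓ₂ ℓ₁₂ ∧
  F.Reflects Q₂ y₁ ℓ ℓ₂ ∧ F.Reflects Q₂ y₂ ℓ₁ ℓ₁₂ ∧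
  ∃ W : Submodule K (HVec K d), finrank K W + 2 = d + 1 ∧
    W ≤ polarHyperplane Q₁ x₁ ∧ W ≤ polarHyperplane Q₁ x₂ ∧
    W ≤ polarHyperplane Q₂ y₁ ∧ W ≤ polarHyperplane Q₂ y₂

end Reflection

section Nets

variable {K : Type*} [Field K] {d m : ℕ}

/-- The `i`-th unit coordinate vector of `Z^m`. -/
def unitVec {m : ℕ} (i : Fin m) : Fin m → ℤ := Pi.single i 1

/-- The point `(n, k)` of `Z^{m+1}`. -/
def latticeSnoc {m : ℕ} (n : Fin m → ℤ) (k : ℤ) : Fin (m + 1) → ℤ :=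
  Fin.snoc (α := fun _ => ℤ) n k

/-- The quadrics `Q₁, …, Q_m` followed by `Qδ`. -/
def quadricSnoc (Q : Fin m → QMat K d) (Qδ : QMat K d) : Fin (m + 1) → QMat K d :=
  Fin.snoc (α := fun _ => QMat K d) Q Qδ

/-- The set of all lines that touch the `d - 1` quadrics `C`. -/
def tangentLines (C : Fin (d - 1) → QMat K d) : Set (PLine K d) :=
  {ℓ | ∀ a, Touches (C a) ℓ}

/-- `φ` is a double reflection net with values in the set of lines touching the `d - 1` quadrics
`C`, for the quadrics `Q₁, …, Q_m` of the confocal system. The vector `P j n` represents the point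
of `Q j` at which `φ n` and `φ (n + e_j)` meet. -/
def ConfocalSystem.IsDoubleReflectionNet (F : ConfocalSystem K d)
    (C : Fin (d - 1) → QMat K d) (Q : Fin m → QMat K d) (φ : (Fin m → ℤ) → PLine K d) : Prop :=
  (∀ j, F.IsMember (Q j)) ∧ (∀ n, φ n ∈ tangentLines C) ∧
  ∃ P : Fin m → (Fin m → ℤ) → HVec K d,
    (∀ (j : Fin m) (n : Fin m → ℤ),
      F.IsBilliardTrajectory (Q j) (fun k => φ (n + k • unitVec j))
        (fun k => P j (n + k • unitVec j))) ∧
    ∀ (i j : Fin m) (n : Fin m → ℤ), i ≠ j →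
      F.IsDoubleReflectionConfiguration (Q i) (Q j)
        (P i n) (P i (n + unitVec j)) (P j n) (P j (n + unitVec i))
        (φ n) (φ (n + unitVec i)) (φ (n + unitVec j)) (φ (n + unitVec i + unitVec j))

/-- `φ'` is an extension of the double reflection net `φ` to `Z^{m+1}`, with additional quadric
`Qδ` and initial line `ℓ'` at `(n₀, 1)`. -/
def ConfocalSystem.IsNetExtension (F : ConfocalSystem K d) (C : Fin (d - 1) → QMat K d)
    (Q : Fin m → QMat K d) (Qδ : QMat K d) (φ : (Fin m → ℤ) → PLine K d)
    (n₀ : Fin m → ℤ) (ℓ' : PLine K d) (φ' : (Fin (m + 1) → ℤ) → PLine K d) : Prop :=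
  F.IsDoubleReflectionNet C (quadricSnoc Q Qδ) φ' ∧
    (∀ n, φ' (latticeSnoc n 0) = φ n) ∧ φ' (latticeSnoc n₀ 1) = ℓ'

/-- A line congruence: neighbouring lines meet. -/
def IsLineCongruence (ψ : (Fin m → ℤ) → PLine K d) : Prop :=
  ∀ (n : Fin m → ℤ) (i : Fin m), LinesMeet (ψ n) (ψ (n + unitVec i))

/-- The line congruence `ψ'` is an F-transformation of the line congruence `ψ` : corresponding
lines meet. -/
def IsFTransformation (ψ ψ' : (Fin m → ℤ) → PLine K d) : Prop :=
  IsLineCongruence ψ ∧ IsLineCongruence ψ' ∧ ∀ n, LinesMeet (ψ n) (ψ' n)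

/-- The lines that arise from `ℓ₀` by finitely many reflections on the quadrics `Q`. -/
inductive ConfocalSystem.Reachable (F : ConfocalSystem K d) (Q : Fin m → QMat K d)
    (ℓ₀ : PLine K d) : PLine K d → Prop
  | start : ConfocalSystem.Reachable F Q ℓ₀ ℓ₀
  | step (j : Fin m) (x : HVec K d) (ℓ₁ ℓ₂ : PLine K d) :
      ConfocalSystem.Reachable F Q ℓ₀ ℓ₁ → F.Reflects (Q j) x ℓ₁ ℓ₂ →
      ConfocalSystem.Reachable F Q ℓ₀ ℓ₂

/-- Reflection of transversal lines at the point `x` of `Q` is nondegenerate: for some quadric of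
the system the pole of the tangent hyperplane at `x` is not in this hyperplane. -/
def ConfocalSystem.IsRegularPoint (F : ConfocalSystem K d) (Q : QMat K d) (x : HVec K d) : Prop :=
  ∃ Q₂ z, F.IsMember Q₂ ∧ IsPoleOfTangent Q Q₂ x z ∧ z ∉ polarHyperplane Q x

/-- No line obtained from `ℓ₀` by reflections on the quadrics `Q` meets one of these quadrics at a
point where reflection is degenerate. -/
def ConfocalSystem.RegularOrbit (F : ConfocalSystem K d) (Q : Fin m → QMat K d)
    (ℓ₀ : PLine K d) : Prop :=
  ∀ ℓ, F.Reachable Q ℓ₀ ℓ → ∀ (j : Fin m) (x : HVec K d), x ∈ ℓ.1 → OnQuadric (Q j) x →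
    F.IsRegularPoint (Q j) x

end Nets

/-! A point of a quadric is recorded by its tangent hyperplane `u`, a covector isotropic for the
dual form `D = Q⁻¹`; the point itself is `D u`. Reflection there is the harmonic homology with axis
`u` and centre the pole `D' u`, for any `D'` in the dual pencil whose pole is off `u`. All these
poles lie on one line through `D u`, so the image of a line through `D u` does not depend on `D'`.
This freedom drives the proof: to follow the points on another quadric `Q j`, take `D' = (Q j)⁻¹`,
whose homology preserves `Q j`, its tangent hyperplanes and the lines touching it.

A line transversal to a quadric at one of their common points meets it in exactly one other point. A
`MarkedLine` is a line with one of its two points on each quadric. The billiard map of `Q j` on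
marked lines reflects at the marked point and then exchanges the marked point on `Q j`. The heart of
the matter is `commute_billiard`: billiard maps of distinct quadrics commute. If `u`, `v` are the
marks on two of them, all hyperplanes of the double reflection lie in the pencil of `u` and `v`, and
`reflection_comp_reflection`, an identity between two products of two reflections, gives the result
for the lines (`reflectLine_pair`) and for the marks on a third quadric (`coReflection_pair`). Hence
the lattice acts on marked lines, and orbits are double reflection nets.

Conversely, every net is an orbit (`IsDoubleReflectionNet.eq_act`). A pencil of hyperplanes contains
at most two tangent to a given quadric when the dual form does not vanish on it, and this determines
the next mark. The only exception is a common normal of the system, which every reflection fixes, so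
that the net is constant.

For (a), mark `φ n₀` by its points of reflection towards its neighbours and towards `ℓ'`. The orbit
under the larger lattice restricts to `φ`, both being orbits of the same marked line, and any
extension is this orbit. For (b), two lines related by a reflection share the point of reflection.
-/

/-! ### Dual forms and harmonic homologies. -/

section DualForms

variable {K : Type*} [Field K] {d : ℕ}

/-- The bilinear form on covectors given by the matrix of a dual quadric. -/
def dualForm (D : QMat K d) (u v : HVec K d) : K := u ⬝ᵥ D.mulVec v

theorem dualForm_add_left (D : QMat K d) (u v w : HVec K d) :
    dualForm D (u + v) w = dualForm D u w + dualForm D v w := by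
  simp [dualForm, add_dotProduct]

theorem dualForm_sub_left (D : QMat K d) (u v w : HVec K d) :
    dualForm D (u - v) w = dualForm D u w - dualForm D v w := by
  simp [dualForm, sub_dotProduct]

theorem dualForm_smul_left (D : QMat K d) (c : K) (u v : HVec K d) :
    dualForm D (c • u) v = c * dualForm D u v := by
  simp [dualForm, smul_dotProduct]

theorem dualForm_add_right (D : QMat K d) (u v w : HVec K d) :
    dualForm D u (v + w) = dualForm D u v + dualForm D u w := by
  simp [dualForm, dotProduct_add, Matrix.mulVec_add]

theorem dualForm_sub_right (D : QMat K d) (u v w : HVec K d) :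
    dualForm D u (v - w) = dualForm D u v - dualForm D u w := by
  simp [dualForm, dotProduct_sub, Matrix.mulVec_sub]

theorem dualForm_smul_right (D : QMat K d) (c : K) (u v : HVec K d) :
    dualForm D u (c • v) = c * dualForm D u v := by
  simp [dualForm, dotProduct_smul, Matrix.mulVec_smul]

theorem dualForm_comm {D : QMat K d} (hD : D.IsSymm) (u v : HVec K d) :
    dualForm D u v = dualForm D v u := by
  unfold dualForm
  rw [Matrix.dotProduct_mulVec, ← Matrix.mulVec_transpose, hD.eq, dotProduct_comm]

theorem dualForm_combination (D₁ D₂ : QMat K d) (α β : K) (u v : HVec K d) :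
    dualForm (α • D₁ + β • D₂) u v = α * dualForm D₁ u v + β * dualForm D₂ u v := by
  simp [dualForm, Matrix.add_mulVec, Matrix.smul_mulVec, dotProduct_add]

/-- The harmonic homology with axis `u` and centre the pole `D u`. It is the identity if the
pole lies in the hyperplane. -/
def poleReflection (D : QMat K d) (u : HVec K d) : HVec K d →ₗ[K] HVec K d where
  toFun w := w - (2 / dualForm D u u * (u ⬝ᵥ w)) • D.mulVec u
  map_add' v w := by rw [dotProduct_add]; module
  map_smul' c w := by rw [dotProduct_smul, RingHom.id_apply, smul_eq_mul]; module

/-- The action of `poleReflection D u` on covectors. -/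
def coReflection (D : QMat K d) (u : HVec K d) : HVec K d →ₗ[K] HVec K d where
  toFun w := w - (2 / dualForm D u u * dualForm D u w) • u
  map_add' v w := by rw [dualForm_add_right]; module
  map_smul' c w := by rw [dualForm_smul_right, RingHom.id_apply]; module

theorem poleReflection_apply (D : QMat K d) (u w : HVec K d) :
    poleReflection D u w = w - (2 / dualForm D u u * (u ⬝ᵥ w)) • D.mulVec u := rfl

theorem coReflection_apply (D : QMat K d) (u w : HVec K d) :
    coReflection D u w = w - (2 / dualForm D u u * dualForm D u w) • u := rfl

theorem poleReflection_involutive (D : QMat K d) (u : HVec K d) :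
    Function.Involutive (poleReflection D u) := by
  intro w
  simp only [poleReflection_apply, dotProduct_sub, dotProduct_smul, smul_eq_mul]
  change _ - (2 / dualForm D u u * (_ - _ * dualForm D u u)) • _ = _
  by_cases h : dualForm D u u = 0
  · simp [h]
  · match_scalars
    · ring
    · field_simp
      ring

theorem coReflection_involutive (D : QMat K d) (u : HVec K d) :
    Function.Involutive (coReflection D u) := by
  intro w
  simp only [coReflection_apply, dualForm_sub_right, dualForm_smul_right]
  by_cases h : dualForm D u u = 0
  · simp [h]
  · match_scalars
    · ring
    · field_simp
      ring

theorem poleReflection_smul (D : QMat K d) {c : K} (hc : c ≠ 0) (u : HVec K d) :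
    poleReflection D (c • u) = poleReflection D u := by
  refine LinearMap.ext fun w => ?_
  simp only [poleReflection_apply, dualForm_smul_right, dualForm_smul_left, smul_dotProduct,
    Matrix.mulVec_smul, smul_eq_mul]
  by_cases h : dualForm D u u = 0
  · simp [h]
  · match_scalars
    · ring
    · field_simp

theorem coReflection_smul (D : QMat K d) {c : K} (hc : c ≠ 0) (u : HVec K d) :
    coReflection D (c • u) = coReflection D u := by
  refine LinearMap.ext fun w => ?_
  simp only [coReflection_apply, dualForm_smul_right, dualForm_smul_left]
  by_cases h : dualForm D u u = 0
  · simp [h]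
  · match_scalars
    · ring
    · field_simp

theorem mulVec_coReflection (D : QMat K d) (u v : HVec K d) :
    D.mulVec (coReflection D u v) = poleReflection D u (D.mulVec v) := by
  simp [coReflection_apply, poleReflection_apply, Matrix.mulVec_sub, Matrix.mulVec_smul, dualForm]

/-- The two maps are contragredient, so incidence of points with hyperplanes is preserved when
points move by one and covectors by the other. -/
theorem coReflection_dotProduct_poleReflection {D : QMat K d} (hD : D.IsSymm)
    (u v w : HVec K d) : coReflection D u v ⬝ᵥ poleReflection D u w = v ⬝ᵥ w := by
  have h : v ⬝ᵥ D.mulVec u = dualForm D u v := by rw [dualForm_comm hD]; rfl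
  have h' : u ⬝ᵥ D.mulVec u = dualForm D u u := rfl
  simp only [coReflection_apply, poleReflection_apply, dotProduct_sub, dotProduct_smul,
    sub_dotProduct, smul_dotProduct, smul_eq_mul, h, h']
  by_cases h : dualForm D u u = 0
  · simp [h]
  · field_simp
    ring

/-- `coReflection D u` is the orthogonal reflection of the form `D`: it is contragredient to
`poleReflection D u`, and `D` intertwines the two. Hence it preserves the covectors tangent to the
quadric. -/
theorem dualForm_coReflection {D : QMat K d} (hD : D.IsSymm) (u v w : HVec K d) :
    dualForm D (coReflection D u v) (coReflection D u w) = dualForm D v w := by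
  unfold dualForm
  rw [mulVec_coReflection, coReflection_dotProduct_poleReflection hD]

theorem dotProduct_poleReflection_self {D : QMat K d} {u : HVec K d} (h : dualForm D u u ≠ 0)
    (w : HVec K d) : u ⬝ᵥ poleReflection D u w = -(u ⬝ᵥ w) := by
  have h' : u ⬝ᵥ D.mulVec u = dualForm D u u := rfl
  simp only [poleReflection_apply, dotProduct_sub, dotProduct_smul, smul_eq_mul, h']
  field_simp
  ring

theorem poleReflection_of_dotProduct_eq_zero (D : QMat K d) {u w : HVec K d} (h : u ⬝ᵥ w = 0) :
    poleReflection D u w = w := by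
  simp [poleReflection_apply, h]

/-- Products of two reflections in a plane, in two pairs of conjugate directions. -/
theorem reflection_comp_reflection {V : Type*} [AddCommGroup V] [Module K V] (h2 : (2 : K) ≠ 0)
    (f g : V →ₗ[K] K) (x y : V) (k l q r : K) (hq : q ≠ 0) (hr : r ≠ 0) (hkl : 1 - k * l ≠ 0)
    (hfx : f x = q) (hgy : g y = r) (hfy : 2 * f y = k * r + l * q)
    (hgx : 2 * g x = k * r + l * q) (w : V) :
    (w - (2 / q * f w) • x) -
        (2 / (r * (1 - k * l)) * (g - l • f) (w - (2 / q * f w) • x)) • (y - l • x) =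
      (w - (2 / r * g w) • y) -
        (2 / (q * (1 - k * l)) * (f - k • g) (w - (2 / r * g w) • y)) • (x - k • y) := by
  have hfy' : f y = (k * r + l * q) / 2 := by field_simp; linear_combination hfy
  have hgx' : g x = (k * r + l * q) / 2 := by field_simp; linear_combination hgx
  simp only [LinearMap.sub_apply, LinearMap.smul_apply, map_sub, map_smul, hfx, hgy, hfy', hgx',
    smul_eq_mul]
  match_scalars
  · ring
  · field_simp
    ring
  · field_simp
    ring

end DualForms

/-! ### Double reflection at two marked points of a line. -/

section MarkedLines

variable {K : Type*} [Field K] {d : ℕ}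

/-- Scalar relations between the covectors `u`, `v` tangent to two dual quadrics and the other
tangent covectors of the pencil that they span. -/
theorem conjugate_pair_scalars {D₁ D₂ : QMat K d} (hD₁ : D₁.IsSymm) (hD₂ : D₂.IsSymm)
    {u v : HVec K d} (hu : dualForm D₁ u u = 0) (hv : dualForm D₂ v v = 0)
    (hc : dualForm D₂ u u ≠ 0) (hb : dualForm D₁ v v ≠ 0) {k l : K}
    (hk : k = 2 / dualForm D₁ v v * dualForm D₁ v u)
    (hl : l = 2 / dualForm D₂ u u * dualForm D₂ u v) :
    dualForm D₁ (v - l • u) (v - l • u) = dualForm D₁ v v * (1 - k * l) ∧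
    dualForm D₂ (u - k • v) (u - k • v) = dualForm D₂ u u * (1 - k * l) ∧
    dualForm D₂ (v - l • u) (v - l • u) = 0 ∧ dualForm D₁ (u - k • v) (u - k • v) = 0 := by
  have h₁ := dualForm_comm hD₁ u v
  have h₂ := dualForm_comm hD₂ u v
  simp only [dualForm_sub_right, dualForm_sub_left, dualForm_smul_left, dualForm_smul_right, hu, hv,
    h₁, h₂] at *
  subst hk hl
  refine ⟨?_, ?_, ?_, ?_⟩ <;> · field_simp; ring

section ConjugatePair

variable (h2 : (2 : K) ≠ 0) {D₁ D₂ : QMat K d} (hD₁ : D₁.IsSymm) (hD₂ : D₂.IsSymm)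
    {u v : HVec K d} (hu : dualForm D₁ u u = 0) (hv : dualForm D₂ v v = 0)
    (hc : dualForm D₂ u u ≠ 0) (hb : dualForm D₁ v v ≠ 0)
    (hv' : dualForm D₁ (coReflection D₂ u v) (coReflection D₂ u v) ≠ 0)

include hD₁ hD₂ hu hv hc hb hv'

theorem coReflection_ne_zero_of_pair :
    dualForm D₂ (coReflection D₁ v u) (coReflection D₁ v u) ≠ 0 := by
  obtain ⟨e₁, e₂, -, -⟩ := conjugate_pair_scalars hD₁ hD₂ hu hv hc hb rfl rfl
  rw [coReflection_apply] at hv' ⊢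
  rw [e₁] at hv'
  rw [e₂]
  exact mul_ne_zero hc (right_ne_zero_of_mul hv')

/-- In the plane of `u` and `v` the form `D₁` has exactly two isotropic directions, `u` and its
mirror image in `v`. A `D₁`-reflection of this plane in any nonisotropic vector exchanges them, so
reflecting `u` in `v` or in the image of `v` gives the same hyperplane. -/
theorem coReflection_other :
    ∃ c : K, c ≠ 0 ∧
      coReflection D₁ (coReflection D₂ u v) u = c • coReflection D₁ v u := by
  obtain ⟨e₁, -, -, -⟩ := conjugate_pair_scalars hD₁ hD₂ hu hv hc hb rfl rfl
  have h₁ := dualForm_comm hD₁ v u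
  rw [coReflection_apply D₂] at hv' ⊢
  rw [e₁] at hv'
  refine ⟨(1 - 2 / dualForm D₁ v v * dualForm D₁ v u * (2 / dualForm D₂ u u * dualForm D₂ u v))⁻¹,
    inv_ne_zero (right_ne_zero_of_mul hv'), ?_⟩
  rw [coReflection_apply, coReflection_apply, e₁]
  have h := right_ne_zero_of_mul hv'
  set k := 2 / dualForm D₁ v v * dualForm D₁ v u with hk
  set l := 2 / dualForm D₂ u u * dualForm D₂ u v
  have hk' : 2 * dualForm D₁ v u = k * dualForm D₁ v v := by rw [hk]; field_simp
  simp only [dualForm_sub_left, dualForm_smul_left, hu]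
  have : 2 / (dualForm D₁ v v * (1 - k * l)) * (dualForm D₁ v u - l * 0) = k / (1 - k * l) := by
    field_simp
    linear_combination hk'
  rw [this]
  match_scalars
  · field_simp
    ring
  · field_simp

include h2

/-- For `D = α D₁ + β D₂` the isotropy of `u` and `v` leaves one term in each of `D(u,u)` and
`D(v,v)`, and the four values of `D` on the hyperplanes take the shape required by
`reflection_comp_reflection`. -/
theorem poleReflection_pair {α β : K} (hα : α ≠ 0) (hβ : β ≠ 0) (w : HVec K d) :
    poleReflection (α • D₁ + β • D₂) (coReflection D₂ u v)
        (poleReflection (α • D₁ + β • D₂) u w) =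
      poleReflection (α • D₁ + β • D₂) (coReflection D₁ v u)
        (poleReflection (α • D₁ + β • D₂) v w) := by
  obtain ⟨e₁, e₂, e₃, e₄⟩ := conjugate_pair_scalars hD₁ hD₂ hu hv hc hb rfl rfl
  have h₁ := dualForm_comm hD₁ v u
  have h₂ := dualForm_comm hD₂ v u
  rw [coReflection_apply] at hv'
  rw [e₁] at hv'
  have hkl := right_ne_zero_of_mul hv'
  set k := 2 / dualForm D₁ v v * dualForm D₁ v u with hk
  set l := 2 / dualForm D₂ u u * dualForm D₂ u v with hl
  have key := reflection_comp_reflection h2 (dotProductBilin K K u) (dotProductBilin K K v)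
    ((α • D₁ + β • D₂).mulVec u) ((α • D₁ + β • D₂).mulVec v) k l
    (β * dualForm D₂ u u) (α * dualForm D₁ v v) (mul_ne_zero hβ hc) (mul_ne_zero hα hb) hkl
    (by change dualForm _ _ _ = _; rw [dualForm_combination, hu]; ring)
    (by change dualForm _ _ _ = _; rw [dualForm_combination, hv]; ring)
    (by change 2 * dualForm _ _ _ = _; rw [dualForm_combination, hk, hl, h₁]; field_simp)
    (by change 2 * dualForm _ _ _ = _; rw [dualForm_combination, hk, hl, h₂]; field_simp) w
  simp only [poleReflection_apply, coReflection_apply, ← hk, ← hl]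
  have q₁ : dualForm (α • D₁ + β • D₂) u u = β * dualForm D₂ u u := by
    rw [dualForm_combination, hu]; ring
  have q₂ : dualForm (α • D₁ + β • D₂) v v = α * dualForm D₁ v v := by
    rw [dualForm_combination, hv]; ring
  have q₃ : dualForm (α • D₁ + β • D₂) (v - l • u) (v - l • u) =
      α * dualForm D₁ v v * (1 - k * l) := by
    rw [dualForm_combination, e₁, e₃]; ring
  have q₄ : dualForm (α • D₁ + β • D₂) (u - k • v) (u - k • v) =
      β * dualForm D₂ u u * (1 - k * l) := by
    rw [dualForm_combination, e₂, e₄]; ring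
  simp only [q₁, q₂, q₃, q₄, Matrix.mulVec_sub, Matrix.mulVec_smul, sub_dotProduct, smul_dotProduct]
  exact key

/-- The covector version of `poleReflection_pair`. It governs the mark on a third quadric, whose
dual matrix is such a combination. -/
theorem coReflection_pair {α β : K} (hα : α ≠ 0) (hβ : β ≠ 0) (w : HVec K d) :
    coReflection (α • D₁ + β • D₂) (coReflection D₂ u v)
        (coReflection (α • D₁ + β • D₂) u w) =
      coReflection (α • D₁ + β • D₂) (coReflection D₁ v u)
        (coReflection (α • D₁ + β • D₂) v w) := by
  obtain ⟨e₁, e₂, e₃, e₄⟩ := conjugate_pair_scalars hD₁ hD₂ hu hv hc hb rfl rfl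
  have h₁ := dualForm_comm hD₁ v u
  have h₂ := dualForm_comm hD₂ v u
  rw [coReflection_apply] at hv'
  rw [e₁] at hv'
  have hkl := right_ne_zero_of_mul hv'
  set k := 2 / dualForm D₁ v v * dualForm D₁ v u with hk
  set l := 2 / dualForm D₂ u u * dualForm D₂ u v with hl
  let D := α • D₁ + β • D₂
  let f : HVec K d → HVec K d →ₗ[K] K := fun u =>
    { toFun := dualForm D u
      map_add' := dualForm_add_right D u
      map_smul' := fun c => dualForm_smul_right D c u }
  have key := reflection_comp_reflection h2 (f u) (f v) u v k l
    (β * dualForm D₂ u u) (α * dualForm D₁ v v) (mul_ne_zero hβ hc) (mul_ne_zero hα hb) hkl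
    (by change dualForm _ _ _ = _; rw [dualForm_combination, hu]; ring)
    (by change dualForm _ _ _ = _; rw [dualForm_combination, hv]; ring)
    (by change 2 * dualForm _ _ _ = _; rw [dualForm_combination, hk, hl, h₁]; field_simp)
    (by change 2 * dualForm _ _ _ = _; rw [dualForm_combination, hk, hl, h₂]; field_simp) w
  simp only [coReflection_apply, ← hk, ← hl]
  have q₁ : dualForm (α • D₁ + β • D₂) u u = β * dualForm D₂ u u := by
    rw [dualForm_combination, hu]; ring
  have q₂ : dualForm (α • D₁ + β • D₂) v v = α * dualForm D₁ v v := by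
    rw [dualForm_combination, hv]; ring
  have q₃ : dualForm (α • D₁ + β • D₂) (v - l • u) (v - l • u) =
      α * dualForm D₁ v v * (1 - k * l) := by
    rw [dualForm_combination, e₁, e₃]; ring
  have q₄ : dualForm (α • D₁ + β • D₂) (u - k • v) (u - k • v) =
      β * dualForm D₂ u u * (1 - k * l) := by
    rw [dualForm_combination, e₂, e₄]; ring
  simp only [q₁, q₂, q₃, q₄, dualForm_sub_left _ _ (_ • _), dualForm_smul_left]
  exact key

end ConjugatePair

/-- The image of a line under `poleReflection`. -/
def reflectLine (D : QMat K d) (u : HVec K d) (ℓ : PLine K d) : PLine K d :=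
  ⟨ℓ.1.map (poleReflection D u),
    (Submodule.equivMapOfInjective _ (poleReflection_involutive D u).injective
      ℓ.1).symm.finrank_eq.trans ℓ.2⟩

/-- The covector `u` is tangent to the dual quadric `D` at a point of the line `ℓ`, and the line is
not in the tangent hyperplane. -/
def Marked (D : QMat K d) (ℓ : PLine K d) (u : HVec K d) : Prop :=
  u ≠ 0 ∧ dualForm D u u = 0 ∧ D.mulVec u ∈ ℓ.1 ∧ ∃ w ∈ ℓ.1, u ⬝ᵥ w ≠ 0

theorem mem_reflectLine {D : QMat K d} {u : HVec K d} {ℓ : PLine K d} {w : HVec K d} :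
    w ∈ (reflectLine D u ℓ).1 ↔ poleReflection D u w ∈ ℓ.1 := by
  constructor
  · rintro ⟨v, hv, rfl⟩
    rwa [poleReflection_involutive D u v]
  · intro h
    exact ⟨_, h, poleReflection_involutive D u w⟩

theorem reflectLine_reflectLine (D : QMat K d) (u : HVec K d) (ℓ : PLine K d) :
    reflectLine D u (reflectLine D u ℓ) = ℓ := by
  ext w
  rw [mem_reflectLine, mem_reflectLine, poleReflection_involutive D u w]

theorem reflectLine_smul (D : QMat K d) {c : K} (hc : c ≠ 0) (u : HVec K d) (ℓ : PLine K d) :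
    reflectLine D (c • u) ℓ = reflectLine D u ℓ := by
  ext w
  rw [mem_reflectLine, mem_reflectLine, poleReflection_smul D hc]

theorem Marked.smul {D : QMat K d} {ℓ : PLine K d} {u : HVec K d} (h : Marked D ℓ u) {c : K}
    (hc : c ≠ 0) : Marked D ℓ (c • u) := by
  obtain ⟨h0, h1, h3, w, hw, h4⟩ := h
  refine ⟨smul_ne_zero hc h0, ?_, ?_, w, hw, ?_⟩
  · rw [dualForm_smul_left, dualForm_smul_right, h1]; simp
  · rw [Matrix.mulVec_smul]; exact ℓ.1.smul_mem _ h3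
  · rw [smul_dotProduct]; exact mul_ne_zero hc h4

theorem Marked.reflectLine_self {D D' : QMat K d} {ℓ : PLine K d} {u : HVec K d}
    (h : Marked D ℓ u) (h' : dualForm D' u u ≠ 0) : Marked D (reflectLine D' u ℓ) u := by
  obtain ⟨h0, h1, h3, w, hw, h4⟩ := h
  refine ⟨h0, h1, ?_, _, Submodule.mem_map_of_mem hw, ?_⟩
  · rw [mem_reflectLine, poleReflection_of_dotProduct_eq_zero _ h1]
    exact h3
  · rw [dotProduct_poleReflection_self h']
    exact neg_ne_zero.2 h4

/-- The homology defined by `D` preserves the quadric dual to `D`, so marks on this quadric travel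
with the line. -/
theorem Marked.coReflection {D : QMat K d} (hD : D.IsSymm) {ℓ : PLine K d} {w : HVec K d}
    (h : Marked D ℓ w) (u : HVec K d) : Marked D (reflectLine D u ℓ) (coReflection D u w) := by
  obtain ⟨h0, h1, h3, v, hv, h4⟩ := h
  refine ⟨?_, ?_, ?_, _, Submodule.mem_map_of_mem hv, ?_⟩
  · rwa [Ne, map_eq_zero_iff _ (coReflection_involutive D u).injective]
  · rwa [dualForm_coReflection hD]
  · rw [mulVec_coReflection]
    exact Submodule.mem_map_of_mem h3
  · rwa [coReflection_dotProduct_poleReflection hD]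

/-- Since `u` is `D₁`-isotropic, adding a multiple of `D₁` only moves the pole along the direction
`D₁ u`, which already lies in the line. -/
theorem Marked.reflectLine_combination {D₁ D₂ : QMat K d} {ℓ : PLine K d} {u : HVec K d}
    (h : Marked D₁ ℓ u) (hc : dualForm D₂ u u ≠ 0) (α : K) {β : K} (hβ : β ≠ 0) :
    reflectLine (α • D₁ + β • D₂) u ℓ = reflectLine D₂ u ℓ := by
  obtain ⟨-, h1, h3, -⟩ := h
  ext w
  rw [mem_reflectLine, mem_reflectLine]
  have : poleReflection (α • D₁ + β • D₂) u w = poleReflection D₂ u w -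
      (2 / (β * dualForm D₂ u u) * (u ⬝ᵥ w) * α) • D₁.mulVec u := by
    simp only [poleReflection_apply, dualForm_combination, h1, Matrix.add_mulVec,
      Matrix.smul_mulVec]
    match_scalars
    · ring
    · field_simp
      ring
    · field_simp
      ring
  rw [this]
  exact ℓ.1.sub_mem_iff_left (ℓ.1.smul_mem _ h3)

/-- The lines obtained by the two double reflections coincide. -/
theorem reflectLine_pair (h2 : (2 : K) ≠ 0) {D₁ D₂ : QMat K d} (hD₁ : D₁.IsSymm) (hD₂ : D₂.IsSymm)
    {ℓ : PLine K d} {u v : HVec K d} (hu : Marked D₁ ℓ u) (hv : Marked D₂ ℓ v)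
    (hc : dualForm D₂ u u ≠ 0) (hb : dualForm D₁ v v ≠ 0)
    (hv' : dualForm D₁ (coReflection D₂ u v) (coReflection D₂ u v) ≠ 0) :
    reflectLine D₁ (coReflection D₂ u v) (reflectLine D₂ u ℓ) =
      reflectLine D₂ (coReflection D₁ v u) (reflectLine D₁ v ℓ) := by
  have hu' := coReflection_ne_zero_of_pair hD₁ hD₂ hu.2.1 hv.2.1 hc hb hv'
  have e₁ := (hv.coReflection hD₂ u).reflectLine_combination hv' 1 (one_ne_zero (α := K))
  have e₂ := (hu.coReflection hD₁ v).reflectLine_combination hu' 1 (one_ne_zero (α := K))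
  have e₃ := hu.reflectLine_combination hc 1 (one_ne_zero (α := K))
  have e₄ := hv.reflectLine_combination hb 1 (one_ne_zero (α := K))
  -- Each of the four reflections may be carried out with the same form `D₁ + D₂`, where
  -- `poleReflection_pair` applies. The form need not be nondegenerate.
  rw [← e₁, ← e₂, ← e₃, ← e₄, add_comm ((1 : K) • D₂)]
  ext w
  simp only [mem_reflectLine]
  have key := poleReflection_pair h2 hD₁ hD₂ hu.2.1 hv.2.1 hc hb hv'
    (one_ne_zero (α := K)) (one_ne_zero (α := K))
  set D := (1 : K) • D₁ + (1 : K) • D₂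
  -- Membership in a reflected line is tested by applying the reflections in the opposite order, so
  -- the inverse of `key` is needed.
  have key' : poleReflection D u (poleReflection D (coReflection D₂ u v) w) =
      poleReflection D v (poleReflection D (coReflection D₁ v u) w) := by
    apply (poleReflection_involutive D u).injective
    apply (poleReflection_involutive D (coReflection D₂ u v)).injective
    rw [poleReflection_involutive, poleReflection_involutive, key, poleReflection_involutive,
      poleReflection_involutive]
  rw [key']

end MarkedLines

/-! ### The dual pencil, and the reflection law as a homology. -/

section PencilMembers

variable {K : Type*} [Field K] {d : ℕ}

/-- The matrix belongs to the dual pencil of the system. -/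
def ConfocalSystem.InPencil (F : ConfocalSystem K d) (D : QMat K d) : Prop :=
  ∃ s t : K, D = s • F.A + t • F.B

theorem ConfocalSystem.InPencil.isSymm {F : ConfocalSystem K d} {D : QMat K d}
    (h : F.InPencil D) : D.IsSymm := by
  obtain ⟨s, t, rfl⟩ := h
  exact (F.symmA.smul s).add (F.symmB.smul t)

theorem ConfocalSystem.IsMember.inPencil {F : ConfocalSystem K d} {Q : QMat K d}
    (h : F.IsMember Q) : F.InPencil Q⁻¹ := h.2.2

theorem ConfocalSystem.IsMember.inv_mulVec_mulVec {F : ConfocalSystem K d} {Q : QMat K d}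
    (h : F.IsMember Q) (x : HVec K d) : Q⁻¹.mulVec (Q.mulVec x) = x := by
  rw [Matrix.mulVec_mulVec, Matrix.nonsing_inv_mul _ h.2.1, Matrix.one_mulVec]

theorem ConfocalSystem.IsMember.mulVec_inv_mulVec {F : ConfocalSystem K d} {Q : QMat K d}
    (h : F.IsMember Q) (x : HVec K d) : Q.mulVec (Q⁻¹.mulVec x) = x := by
  rw [Matrix.mulVec_mulVec, Matrix.mul_nonsing_inv _ h.2.1, Matrix.one_mulVec]

theorem ConfocalSystem.IsMember.inv_mulVec_injective {F : ConfocalSystem K d} {Q : QMat K d}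
    (h : F.IsMember Q) : Function.Injective Q⁻¹.mulVec := fun u v huv => by
  rw [← h.mulVec_inv_mulVec u, huv, h.mulVec_inv_mulVec]

/-- Two elements of the pencil span it if they are not both multiples of a common one. -/
theorem ConfocalSystem.InPencil.exists_combination {F : ConfocalSystem K d} {D₁ D₂ D : QMat K d}
    (h₁ : F.InPencil D₁) (h₂ : F.InPencil D₂) (h : F.InPencil D) (h0 : D₁ ≠ 0)
    (hne : ∀ c : K, D₂ ≠ c • D₁) : ∃ α β : K, D = α • D₁ + β • D₂ := by
  obtain ⟨s₁, t₁, rfl⟩ := h₁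
  obtain ⟨s₂, t₂, rfl⟩ := h₂
  obtain ⟨s, t, rfl⟩ := h
  by_cases hdet : s₁ * t₂ - s₂ * t₁ = 0
  · exfalso
    by_cases hs : s₁ = 0
    · have ht : t₁ ≠ 0 := by
        rintro rfl
        exact h0 (by simp [hs])
      have : s₂ = 0 := by
        rw [hs] at hdet
        simpa [ht] using hdet
      refine hne (t₂ / t₁) ?_
      rw [hs, this]
      match_scalars
      · ring
      · field_simp
    · refine hne (s₂ / s₁) ?_
      match_scalars
      · field_simp
      · field_simp
        linear_combination hdet
  · obtain ⟨i, hi⟩ : ∃ i, i * (s₁ * t₂ - s₂ * t₁) = 1 := ⟨_, inv_mul_cancel₀ hdet⟩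
    -- Cramer's rule, with `i` the inverse of the determinant.
    refine ⟨(s * t₂ - t * s₂) * i, (t * s₁ - s * t₁) * i, ?_⟩
    match_scalars
    · linear_combination -s * hi
    · linear_combination -t * hi

theorem triple_independent_iff {x p q : HVec K d} : LinearIndependent K ![x, p, q] ↔
    ∀ a b c : K, a • x + b • p + c • q = 0 → a = 0 ∧ b = 0 ∧ c = 0 := by
  rw [Fintype.linearIndependent_iff]
  constructor
  · intro h a b c habc
    have := h ![a, b, c] (by simpa [Fin.sum_univ_three] using habc)
    exact ⟨this 0, this 1, this 2⟩
  · intro h g hg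
    obtain ⟨h0, h1, h2⟩ := h (g 0) (g 1) (g 2) (by simpa [Fin.sum_univ_three] using hg)
    intro i
    fin_cases i <;> assumption

theorem independent_of_dotProduct {u x w : HVec K d} (hx : x ≠ 0) (hux : u ⬝ᵥ x = 0)
    (huw : u ⬝ᵥ w ≠ 0) : LinearIndependent K ![x, w] := by
  rw [LinearIndependent.pair_iff]
  intro s t h
  have ht : t = 0 := by
    have := congrArg (u ⬝ᵥ ·) h
    simpa [hux, huw] using this
  subst ht
  simpa [hx] using h

theorem PLine.eq_span {ℓ : PLine K d} {x y : HVec K d} (hx : x ∈ ℓ.1) (hy : y ∈ ℓ.1)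
    (h : LinearIndependent K ![x, y]) : ℓ.1 = Submodule.span K {x, y} := by
  have : FiniteDimensional K ℓ.1 := inferInstance
  symm
  apply Submodule.eq_of_le_of_finrank_eq
  · rw [Submodule.span_le]
    rintro w (rfl | rfl) <;> assumption
  · have := finrank_span_eq_card h
    rw [Matrix.range_cons_cons_empty, Fintype.card_fin] at this
    rw [this, ℓ.2]

theorem PLine.eq_of_mem {ℓ ℓ' : PLine K d} {x y : HVec K d} (hx : x ∈ ℓ.1) (hy : y ∈ ℓ.1)
    (hx' : x ∈ ℓ'.1) (hy' : y ∈ ℓ'.1) (h : LinearIndependent K ![x, y]) : ℓ = ℓ' :=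
  Subtype.ext ((PLine.eq_span hx hy h).trans (PLine.eq_span hx' hy' h).symm)

theorem ConfocalSystem.IsMember.inv_ne_zero {F : ConfocalSystem K d} {Q : QMat K d}
    (h : F.IsMember Q) : Q⁻¹ ≠ 0 := by
  intro h0
  have := Matrix.nonsing_inv_mul _ h.2.1
  rw [h0, zero_mul] at this
  exact zero_ne_one this

theorem ConfocalSystem.IsMember.inv_ne_smul_inv {F : ConfocalSystem K d} {Q₁ Q₂ : QMat K d}
    (h₁ : F.IsMember Q₁) (h₂ : F.IsMember Q₂) (hne : ¬ SameQuadric Q₁ Q₂) (c : K) :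
    Q₂⁻¹ ≠ c • Q₁⁻¹ := by
  intro h
  have hc : c ≠ 0 := by
    rintro rfl
    exact h₂.inv_ne_zero (by rw [h, zero_smul])
  refine hne ⟨c⁻¹, _root_.inv_ne_zero hc, ?_⟩
  have e₁ : Q₁ * Q₁⁻¹ = 1 := Matrix.mul_nonsing_inv _ h₁.2.1
  have e₂ : Q₂⁻¹ * Q₂ = 1 := Matrix.nonsing_inv_mul _ h₂.2.1
  have : Q₁ = c • Q₂ := by
    calc Q₁ = Q₁ * (Q₂⁻¹ * Q₂) := by rw [e₂, mul_one]
      _ = c • Q₂ := by rw [h, Matrix.smul_mul, Matrix.mul_smul, ← mul_assoc, e₁, one_mul]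
  rw [this, smul_smul, inv_mul_cancel₀ hc, one_smul]

theorem ConfocalSystem.InPencil.exists_combination_of_dualForm {F : ConfocalSystem K d}
    {D₁ D₂ D : QMat K d} (h₁ : F.InPencil D₁) (h₂ : F.InPencil D₂) (h : F.InPencil D) (h0 : D₁ ≠ 0)
    {u : HVec K d} (hu : dualForm D₁ u u = 0) (hc : dualForm D₂ u u ≠ 0) :
    ∃ α β : K, D = α • D₁ + β • D₂ ∧ dualForm D u u = β * dualForm D₂ u u := by
  obtain ⟨α, β, rfl⟩ := h₁.exists_combination h₂ h h0 fun c hcD => hc (by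
    have := dualForm_combination D₁ 0 c 0 u u
    simp only [smul_zero, add_zero, ← hcD] at this
    rw [this, hu]
    ring)
  refine ⟨α, β, rfl, ?_⟩
  rw [dualForm_combination, hu]
  ring

/-- The reflected line does not depend on the choice of the second quadric. -/
theorem Marked.reflectLine_eq {F : ConfocalSystem K d} {D₁ D₂ D : QMat K d}
    (h₁ : F.InPencil D₁) (h₂ : F.InPencil D₂) (h : F.InPencil D) (h0 : D₁ ≠ 0)
    {u : HVec K d} {ℓ : PLine K d} (hu : Marked D₁ ℓ u) (hc : dualForm D₂ u u ≠ 0)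
    (hc' : dualForm D u u ≠ 0) : reflectLine D u ℓ = reflectLine D₂ u ℓ := by
  obtain ⟨α, β, rfl, e⟩ := h₁.exists_combination_of_dualForm h₂ h h0 hu.2.1 hc
  exact hu.reflectLine_combination hc α (left_ne_zero_of_mul (e ▸ hc'))

/-- Two distinct members span the pencil, so a covector isotropic for both would be isotropic for
every `D`. -/
theorem ConfocalSystem.InPencil.dualForm_ne_zero {F : ConfocalSystem K d} {Q₁ Q₂ D : QMat K d}
    (h₁ : F.IsMember Q₁) (h₂ : F.IsMember Q₂) (hne : ¬ SameQuadric Q₁ Q₂) (h : F.InPencil D)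
    {u : HVec K d} (hu : dualForm Q₁⁻¹ u u = 0) (hc : dualForm D u u ≠ 0) :
    dualForm Q₂⁻¹ u u ≠ 0 := by
  intro h0
  obtain ⟨α, β, rfl⟩ := h₁.inPencil.exists_combination h₂.inPencil h h₁.inv_ne_zero
    (h₁.inv_ne_smul_inv h₂ hne)
  rw [dualForm_combination, hu, h0] at hc
  simp at hc

theorem HarmonicLines.symm {x : HVec K d} {n t ℓ₁ ℓ₂ : Submodule K (HVec K d)}
    (h : HarmonicLines x n t ℓ₁ ℓ₂) : HarmonicLines x n t ℓ₂ ℓ₁ := by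
  obtain ⟨p, q, c, hi, hn, ht, h₁, h₂⟩ := h
  refine ⟨p, q, -c, hi, hn, ht, ?_, ?_⟩
  · rw [h₂, neg_smul, sub_eq_add_neg]
  · rw [h₁, neg_smul, sub_neg_eq_add]

theorem ConfocalSystem.Reflects.symm {F : ConfocalSystem K d} {Q : QMat K d} {x : HVec K d}
    {ℓ₁ ℓ₂ : PLine K d} (h : F.Reflects Q x ℓ₁ ℓ₂) : F.Reflects Q x ℓ₂ ℓ₁ := by
  obtain ⟨Q₂, hQ₂, hne, hx, z, hz, t, ht, hh⟩ := h
  exact ⟨Q₂, hQ₂, hne, hx, z, hz, t, ht, hh.symm⟩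

/-- Translation of the harmonic law: the homology fixes `x` and `q` and negates the pole `z`, so it
exchanges the two harmonic lines. -/
theorem ConfocalSystem.Reflects.marked {F : ConfocalSystem K d} {Q : QMat K d} (hQ : F.IsMember Q)
    {x : HVec K d} {ℓ₁ ℓ₂ : PLine K d} (h : F.Reflects Q x ℓ₁ ℓ₂) :
    Marked Q⁻¹ ℓ₁ (Q.mulVec x) ∧ ∃ Q₂, F.IsMember Q₂ ∧
      dualForm Q₂⁻¹ (Q.mulVec x) (Q.mulVec x) ≠ 0 ∧ ℓ₂ = reflectLine Q₂⁻¹ (Q.mulVec x) ℓ₁ := by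
  obtain ⟨Q₂, hQ₂, hne, ⟨hx0, hx⟩, z, hz, t, ht, p, q, c, hi, hn, rfl, h₁, h₂⟩ := h
  have hz' : z = Q₂⁻¹.mulVec (Q.mulVec x) := by
    rw [← hz, hQ₂.inv_mulVec_mulVec]
  have hQx : Q⁻¹.mulVec (Q.mulVec x) = x := hQ.inv_mulVec_mulVec x
  set u := Q.mulVec x with hu
  have hux : u ⬝ᵥ x = 0 := by rw [dotProduct_comm]; exact hx
  have huq : u ⬝ᵥ q = 0 := by
    have : q ∈ Submodule.span K {x, q} := Submodule.subset_span (by simp)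
    rw [← ht] at this
    exact this.2
  have hp : p ∈ Submodule.span K {x, z} := by
    rw [hn]; exact Submodule.subset_span (by simp)
  obtain ⟨α, β, rfl⟩ := Submodule.mem_span_pair.1 hp
  -- If `z` were in `u`, the condition that the plane cuts `u` exactly in `t` would put `p` in `t`,
  -- against the independence of `x`, `p`, `q`.
  have huz : u ⬝ᵥ z ≠ 0 := by
    intro h0
    have : α • x + β • z ∈ Submodule.span K {x, q} := by
      rw [← ht]
      refine ⟨Submodule.mem_sup_left hp, ?_⟩
      change u ⬝ᵥ _ = 0
      simp [hux, h0]
    obtain ⟨a, b, hab⟩ := Submodule.mem_span_pair.1 this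
    exact one_ne_zero (triple_independent_iff.1 hi (-a) 1 (-b) (by rw [← hab]; module)).2.1
  have hβ : β ≠ 0 := by
    rintro rfl
    exact one_ne_zero (triple_independent_iff.1 hi (-α) 1 0 (by module)).2.1
  have hw : u ⬝ᵥ (α • x + β • z + c • q) ≠ 0 := by
    simp [hux, huq, hβ, huz]
  have hx₁ : x ∈ ℓ₁.1 := by
    rw [h₁]; exact Submodule.subset_span (by simp)
  have hw₁ : α • x + β • z + c • q ∈ ℓ₁.1 := by
    rw [h₁]; exact Submodule.subset_span (by simp)
  have hc : dualForm Q₂⁻¹ u u ≠ 0 := by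
    unfold dualForm; rwa [← hz']
  refine ⟨⟨?_, ?_, by rwa [hQx], _, hw₁, hw⟩, Q₂, hQ₂, hc, ?_⟩
  · intro h0
    rw [h0] at huz
    simp at huz
  · unfold dualForm
    rwa [hQx]
  · refine PLine.eq_of_mem (x := x) (y := α • x + β • z - c • q) ?_ ?_ ?_ ?_ ?_
    · rw [h₂]; exact Submodule.subset_span (by simp)
    · rw [h₂]; exact Submodule.subset_span (by simp)
    · rwa [mem_reflectLine, poleReflection_of_dotProduct_eq_zero _ hux]
    · have hzz : poleReflection Q₂⁻¹ u z = -z := by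
        rw [poleReflection_apply, hz']
        change _ - (2 / _ * dualForm Q₂⁻¹ u u) • _ = _
        rw [div_mul_cancel₀ _ hc]
        module
      rw [mem_reflectLine, map_sub, map_add, map_smul, map_smul, map_smul, hzz,
        poleReflection_of_dotProduct_eq_zero _ hux, poleReflection_of_dotProduct_eq_zero _ huq]
      have : α • x + β • -z - c • q = (2 * α) • x - (α • x + β • z + c • q) := by module
      rw [this]
      exact ℓ₁.1.sub_mem (ℓ₁.1.smul_mem _ hx₁) hw₁
    · refine independent_of_dotProduct (u := u) hx0 hux ?_
      simp [hux, huq, hβ, huz]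

theorem sup_inf_polarHyperplane {Q : QMat K d} {x p q : HVec K d}
    (hx : Q.mulVec x ⬝ᵥ x = 0) (hq : Q.mulVec x ⬝ᵥ q = 0) (hp : Q.mulVec x ⬝ᵥ p ≠ 0) :
    (Submodule.span K {x, p} ⊔ Submodule.span K {x, q}) ⊓ polarHyperplane Q x =
      Submodule.span K {x, q} := by
  apply le_antisymm
  · rintro w ⟨hw, hw'⟩
    obtain ⟨y, hy, z, hz, rfl⟩ := Submodule.mem_sup.1 hw
    obtain ⟨a, b, rfl⟩ := Submodule.mem_span_pair.1 hy
    obtain ⟨a', b', rfl⟩ := Submodule.mem_span_pair.1 hz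
    change Q.mulVec x ⬝ᵥ _ = 0 at hw'
    have hb : b = 0 := by simpa [hx, hq, hp] using hw'
    subst hb
    exact Submodule.mem_span_pair.2 ⟨a + a', b', by module⟩
  · refine le_inf le_sup_right ?_
    rw [Submodule.span_le]
    rintro w (rfl | rfl)
    · exact hx
    · exact hq

theorem exists_independent_dotProduct_eq_zero (hd : 2 ≤ d) (u x : HVec K d) (hx : x ≠ 0) :
    ∃ q : HVec K d, u ⬝ᵥ q = 0 ∧ LinearIndependent K ![x, q] := by
  have h₁ : d ≤ finrank K (LinearMap.ker (dotProductBilin K K u)) := by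
    have := LinearMap.finrank_range_add_finrank_ker (dotProductBilin K K u)
    have h' := Submodule.finrank_le (LinearMap.range (dotProductBilin K K u))
    rw [finrank_fin_fun] at this
    rw [finrank_self] at h'
    omega
  have h₂ : finrank K (Submodule.span K {x}) = 1 := finrank_span_singleton hx
  have h₃ : ¬ LinearMap.ker (dotProductBilin K K u) ≤ Submodule.span K {x} := fun h => by
    have := (h₁.trans (Submodule.finrank_mono h)).trans h₂.le
    omega
  obtain ⟨q, hq, hqx⟩ := SetLike.not_le_iff_exists.1 h₃
  refine ⟨q, hq, ?_⟩
  rw [LinearIndependent.pair_iff' hx]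
  rintro a rfl
  exact hqx (Submodule.smul_mem _ _ (Submodule.mem_span_singleton_self x))

/-- Converse translation: normalise a vector of the line as `z + c • q` with `q` in the hyperplane
`u`; the harmonic conjugate is then spanned with `z - c • q`. -/
theorem ConfocalSystem.reflects_of_marked (hd : 2 ≤ d) {F : ConfocalSystem K d}
    {Q Q₂ : QMat K d} (hQ : F.IsMember Q) (hQ₂ : F.IsMember Q₂) {u : HVec K d} {ℓ : PLine K d}
    (hu : Marked Q⁻¹ ℓ u) (hc : dualForm Q₂⁻¹ u u ≠ 0) :
    F.Reflects Q (Q⁻¹.mulVec u) ℓ (reflectLine Q₂⁻¹ u ℓ) := by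
  obtain ⟨h0, h1, h3, w, hw, h4⟩ := hu
  have hQu : Q.mulVec (Q⁻¹.mulVec u) = u := hQ.mulVec_inv_mulVec u
  set x := Q⁻¹.mulVec u with hx
  set z := Q₂⁻¹.mulVec u with hz
  have hx0 : x ≠ 0 := by
    intro h
    rw [h, Matrix.mulVec_zero] at hQu
    exact h0 hQu.symm
  have huz : u ⬝ᵥ z ≠ 0 := hc
  have hux : u ⬝ᵥ x = 0 := h1
  obtain ⟨q, c, huq, hxq, w', hw', e⟩ : ∃ (q : HVec K d) (c : K), u ⬝ᵥ q = 0 ∧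
      LinearIndependent K ![x, q] ∧ ∃ w' ∈ ℓ.1, w' = z + c • q := by
    -- The factor makes the scaled `w` and `z` agree on `u`, so their difference lies in `u`.
    set r := ((u ⬝ᵥ z) / (u ⬝ᵥ w)) • w - z with hr
    have hur : u ⬝ᵥ r = 0 := by
      rw [hr, dotProduct_sub, dotProduct_smul, smul_eq_mul, div_mul_cancel₀ _ h4, sub_self]
    by_cases hi : LinearIndependent K ![x, r]
    · exact ⟨r, 1, hur, hi, _, ℓ.1.smul_mem ((u ⬝ᵥ z) / (u ⬝ᵥ w)) hw, by rw [hr]; module⟩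
    · rw [LinearIndependent.pair_iff' hx0] at hi
      push Not at hi
      obtain ⟨a, ha⟩ := hi
      -- Here the line is the normal `xz`. Any direction `q` of `u` away from `x` serves, with `c =
      -- 0`; this needs `d ≥ 2`.
      obtain ⟨q, huq, hxq⟩ := exists_independent_dotProduct_eq_zero hd u x hx0
      refine ⟨q, 0, huq, hxq, _, ℓ.1.sub_mem (ℓ.1.smul_mem ((u ⬝ᵥ z) / (u ⬝ᵥ w)) hw)
        (ℓ.1.smul_mem a h3), ?_⟩
      rw [ha, hr]
      module
  subst e
  refine ⟨Q₂, hQ₂, ?_, ⟨hx0, ?_⟩, z, ?_, Submodule.span K {x, q}, ?_, z, q, c, ?_, rfl, rfl, ?_, ?_⟩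
  · rintro ⟨b, hb, rfl⟩
    apply huz
    have : b • Q.mulVec z = u := by
      rw [← Matrix.smul_mulVec]; exact hQ₂.mulVec_inv_mulVec u
    have hz' : z = b⁻¹ • x := by
      rw [hx, ← hQ.inv_mulVec_mulVec z, ← Matrix.mulVec_smul, ← this, smul_smul,
        inv_mul_cancel₀ hb, one_smul]
    rw [hz', dotProduct_smul, hux, smul_zero]
  · rw [hQu, dotProduct_comm, hux]
  · exact (hQ₂.mulVec_inv_mulVec u).trans hQu.symm
  · exact sup_inf_polarHyperplane (by rw [hQu, hux]) (by rw [hQu, huq]) (by rwa [hQu])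
  · rw [triple_independent_iff]
    intro a b c' habc
    have hb : b = 0 := by
      have := congrArg (u ⬝ᵥ ·) habc
      simpa [hux, huq, huz] using this
    subst hb
    obtain ⟨ha, hc'⟩ := LinearIndependent.pair_iff.1 hxq a c' (by simpa using habc)
    exact ⟨ha, rfl, hc'⟩
  · exact PLine.eq_span h3 hw' (independent_of_dotProduct hx0 hux (by simp [huq, huz]))
  · have hzz : poleReflection Q₂⁻¹ u z = -z := by
      rw [poleReflection_apply]
      change _ - (2 / _ * dualForm Q₂⁻¹ u u) • z = _
      rw [div_mul_cancel₀ _ hc]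
      module
    refine PLine.eq_span ?_ ?_ (independent_of_dotProduct hx0 hux (by simp [huq, huz]))
    · rwa [mem_reflectLine, poleReflection_of_dotProduct_eq_zero _ hux]
    · rw [mem_reflectLine, map_sub, map_smul, hzz, poleReflection_of_dotProduct_eq_zero _ huq]
      have : -z - c • q = -(z + c • q) := by module
      rw [this]
      exact ℓ.1.neg_mem hw'

end PencilMembers

/-! ### The two points of a line on a quadric, as projective covectors. -/

section ProjectiveMarks

variable {K : Type*} [Field K] {d : ℕ}

/-- On the covectors of points of the line the dual form is a binary quadratic form with the zero
`u`. Transversality makes the zero simple, and division by `2` yields the other one. -/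
theorem Marked.exists_other (h2 : (2 : K) ≠ 0) {F : ConfocalSystem K d} {Q : QMat K d}
    (hQ : F.IsMember Q) {ℓ : PLine K d} {u : HVec K d} (h : Marked Q⁻¹ ℓ u) :
    ∃ v, Marked Q⁻¹ ℓ v ∧ LinearIndependent K ![u, v] := by
  obtain ⟨h0, h1, h3, w, hw, h4⟩ := h
  have hsymm := dualForm_comm hQ.inPencil.isSymm
  have hDw : Q⁻¹.mulVec (Q.mulVec w) = w := hQ.inv_mulVec_mulVec w
  set v := Q.mulVec w with hv
  have ha : dualForm Q⁻¹ u v = u ⬝ᵥ w := by unfold dualForm; rw [hDw]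
  rw [← ha] at h4
  set t := dualForm Q⁻¹ v v / (2 * dualForm Q⁻¹ u v) with ht
  have huv : dualForm Q⁻¹ (v - t • u) u = dualForm Q⁻¹ u v := by
    rw [dualForm_sub_left, dualForm_smul_left, h1, hsymm v u]; ring
  refine ⟨v - t • u, ⟨?_, ?_, ?_, _, h3, ?_⟩, ?_⟩
  · intro h
    rw [h] at huv
    exact h4 (huv.symm.trans (by simp [dualForm]))
  · rw [dualForm_sub_right, dualForm_smul_right, huv, dualForm_sub_left, dualForm_smul_left, ht]
    field_simp
    ring
  · rw [Matrix.mulVec_sub, Matrix.mulVec_smul, hDw]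
    exact ℓ.1.sub_mem hw (ℓ.1.smul_mem _ h3)
  · change dualForm _ _ _ ≠ 0
    rwa [huv]
  · rw [LinearIndependent.pair_iff' h0]
    intro a hau
    rw [← hau, dualForm_smul_left, h1, mul_zero] at huv
    exact h4 huv.symm

theorem mulVec_independent {F : ConfocalSystem K d} {Q : QMat K d} (hQ : F.IsMember Q)
    {u v : HVec K d} (h : LinearIndependent K ![u, v]) :
    LinearIndependent K ![Q⁻¹.mulVec u, Q⁻¹.mulVec v] := by
  rw [LinearIndependent.pair_iff] at h ⊢
  intro s t hst
  refine h s t (hQ.inv_mulVec_injective ?_)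
  rw [Matrix.mulVec_add, Matrix.mulVec_smul, Matrix.mulVec_smul, hst, Matrix.mulVec_zero]

theorem Marked.eq_combination {F : ConfocalSystem K d} {Q : QMat K d}
    (hQ : F.IsMember Q) {ℓ : PLine K d} {u v w : HVec K d} (hu : Q⁻¹.mulVec u ∈ ℓ.1)
    (hv : Q⁻¹.mulVec v ∈ ℓ.1) (huv : LinearIndependent K ![u, v]) (hw : Q⁻¹.mulVec w ∈ ℓ.1) :
    ∃ α β : K, w = α • u + β • v := by
  rw [PLine.eq_span hu hv (mulVec_independent hQ huv)] at hw
  obtain ⟨α, β, h⟩ := Submodule.mem_span_pair.1 hw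
  refine ⟨α, β, hQ.inv_mulVec_injective ?_⟩
  rw [← h, Matrix.mulVec_add, Matrix.mulVec_smul, Matrix.mulVec_smul]

theorem Marked.dualForm_ne_zero {F : ConfocalSystem K d} {Q : QMat K d}
    (hQ : F.IsMember Q) {ℓ : PLine K d} {u v : HVec K d} (hu : Marked Q⁻¹ ℓ u)
    (hv : Q⁻¹.mulVec v ∈ ℓ.1) (huv : LinearIndependent K ![u, v]) : dualForm Q⁻¹ u v ≠ 0 := by
  obtain ⟨-, h1, h3, w, hw, h4⟩ := hu
  intro h
  rw [PLine.eq_span h3 hv (mulVec_independent hQ huv)] at hw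
  obtain ⟨α, β, rfl⟩ := Submodule.mem_span_pair.1 hw
  apply h4
  have h1' : u ⬝ᵥ Q⁻¹.mulVec u = 0 := h1
  have h' : u ⬝ᵥ Q⁻¹.mulVec v = 0 := h
  simp [h1', h']

/-- In the basis of the two zeros the form is `2αβ D(u,v)`, with `D(u,v) ≠ 0` by transversality. -/
theorem Marked.eq_smul_or (h2 : (2 : K) ≠ 0) {F : ConfocalSystem K d} {Q : QMat K d}
    (hQ : F.IsMember Q) {ℓ : PLine K d} {u v w : HVec K d} (hu : Marked Q⁻¹ ℓ u)
    (hv : Marked Q⁻¹ ℓ v) (huv : LinearIndependent K ![u, v])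
    (hw : dualForm Q⁻¹ w w = 0) (hw' : Q⁻¹.mulVec w ∈ ℓ.1) :
    ∃ c : K, w = c • u ∨ w = c • v := by
  have hne := hu.dualForm_ne_zero hQ hv.2.2.1 huv
  obtain ⟨α, β, rfl⟩ := Marked.eq_combination hQ hu.2.2.1 hv.2.2.1 huv hw'
  simp only [dualForm_add_left, dualForm_add_right, dualForm_smul_left, dualForm_smul_right,
    hu.2.1, hv.2.1, dualForm_comm hQ.inPencil.isSymm v u] at hw
  have : 2 * dualForm Q⁻¹ u v * (α * β) = 0 := by linear_combination hw
  rcases mul_eq_zero.1 ((mul_eq_zero.1 this).resolve_left (mul_ne_zero h2 hne)) with h | h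
  · exact ⟨β, Or.inr (by rw [h]; module)⟩
  · exact ⟨α, Or.inl (by rw [h]; module)⟩

theorem marked_rep_mk {D : QMat K d} {ℓ : PLine K d} {u : HVec K d} (hu : u ≠ 0) :
    Marked D ℓ (Projectivization.mk K u hu).rep ↔ Marked D ℓ u := by
  obtain ⟨a, ha⟩ := Projectivization.exists_smul_eq_mk_rep K u hu
  rw [← ha]
  constructor
  · intro h
    have := h.smul (Units.ne_zero a⁻¹)
    rwa [← Units.smul_def, inv_smul_smul] at this
  · intro h
    exact h.smul (Units.ne_zero a)

theorem Projectivization.mk_ne_mk_of_independent {u v : HVec K d} (hu : u ≠ 0) (hv : v ≠ 0)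
    (h : LinearIndependent K ![u, v]) :
    Projectivization.mk K v hv ≠ Projectivization.mk K u hu := by
  intro h'
  obtain ⟨a, ha⟩ := (Projectivization.mk_eq_mk_iff' K v u hv hu).1 h'
  exact (LinearIndependent.pair_iff' hu).1 h a ha

/-- The image of a projective class of covectors under `coReflection`. -/
noncomputable def coReflectionP (D : QMat K d) (u : HVec K d) :
    Projectivization K (HVec K d) → Projectivization K (HVec K d) :=
  Projectivization.map (coReflection D u) (coReflection_involutive D u).injective

theorem coReflection_ne_zero {D : QMat K d} {u v : HVec K d} (hv : v ≠ 0) :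
    coReflection D u v ≠ 0 := by
  rwa [Ne, map_eq_zero_iff _ (coReflection_involutive D u).injective]

theorem coReflectionP_mk (D : QMat K d) (u v : HVec K d) (hv : v ≠ 0) :
    coReflectionP D u (Projectivization.mk K v hv) =
      Projectivization.mk K (coReflection D u v) (coReflection_ne_zero hv) := rfl

theorem coReflectionP_eq_mk (D : QMat K d) (u : HVec K d) (p : Projectivization K (HVec K d)) :
    coReflectionP D u p =
      Projectivization.mk K (coReflection D u p.rep) (coReflection_ne_zero p.rep_nonzero) := by
  rw [← coReflectionP_mk D u p.rep p.rep_nonzero, Projectivization.mk_rep]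

theorem coReflectionP_involutive (D : QMat K d) (u : HVec K d) :
    Function.Involutive (coReflectionP D u) := by
  intro p
  induction p using Projectivization.ind with
  | h v hv =>
    rw [coReflectionP_mk, coReflectionP_mk, Projectivization.mk_eq_mk_iff']
    exact ⟨1, by rw [one_smul, coReflection_involutive D u v]⟩

theorem coReflectionP_rep_mk (D : QMat K d) (u : HVec K d) (hu : u ≠ 0) :
    coReflectionP D (Projectivization.mk K u hu).rep = coReflectionP D u := by
  obtain ⟨a, ha⟩ := Projectivization.exists_smul_eq_mk_rep K u hu
  funext p
  rw [coReflectionP_eq_mk, coReflectionP_eq_mk, Projectivization.mk_eq_mk_iff']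
  exact ⟨1, by rw [one_smul, ← ha, Units.smul_def, coReflection_smul D (Units.ne_zero a)]⟩

theorem marked_coReflectionP {D : QMat K d} (hD : D.IsSymm) {ℓ : PLine K d} (u : HVec K d)
    {p : Projectivization K (HVec K d)} (h : Marked D ℓ p.rep) :
    Marked D (reflectLine D u ℓ) (coReflectionP D u p).rep := by
  rw [coReflectionP_eq_mk, marked_rep_mk]
  exact h.coReflection hD u

theorem existsUnique_other (h2 : (2 : K) ≠ 0) {F : ConfocalSystem K d} {Q : QMat K d}
    (hQ : F.IsMember Q) {ℓ : PLine K d} {p : Projectivization K (HVec K d)}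
    (h : Marked Q⁻¹ ℓ p.rep) :
    ∃! q : Projectivization K (HVec K d), Marked Q⁻¹ ℓ q.rep ∧ q ≠ p := by
  obtain ⟨v, hv, hpv⟩ := h.exists_other h2 hQ
  refine ⟨Projectivization.mk K v hv.1, ⟨(marked_rep_mk hv.1).2 hv, ?_⟩, ?_⟩
  · rw [← p.mk_rep]
    exact Projectivization.mk_ne_mk_of_independent p.rep_nonzero hv.1 hpv
  · rintro q ⟨hq, hqp⟩
    obtain ⟨c, hc | hc⟩ := h.eq_smul_or h2 hQ hv hpv hq.2.1 hq.2.2.1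
    · exfalso
      apply hqp
      rw [← p.mk_rep, ← q.mk_rep, Projectivization.mk_eq_mk_iff']
      exact ⟨c, hc.symm⟩
    · rw [← q.mk_rep, Projectivization.mk_eq_mk_iff']
      exact ⟨c, hc.symm⟩

open Classical in
/-- The second tangent covector of the dual quadric `D` at a point of the line `ℓ`. -/
noncomputable def otherMark (D : QMat K d) (ℓ : PLine K d) (p : Projectivization K (HVec K d)) :
    Projectivization K (HVec K d) :=
  if h : ∃ q : Projectivization K (HVec K d), Marked D ℓ q.rep ∧ q ≠ p then h.choose else p

section Other

variable (h2 : (2 : K) ≠ 0) {F : ConfocalSystem K d} {Q : QMat K d} (hQ : F.IsMember Q)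
  {ℓ : PLine K d} {p : Projectivization K (HVec K d)} (h : Marked Q⁻¹ ℓ p.rep)

include h2 hQ h

theorem otherMark_spec : Marked Q⁻¹ ℓ (otherMark Q⁻¹ ℓ p).rep ∧ otherMark Q⁻¹ ℓ p ≠ p := by
  have h' := (existsUnique_other h2 hQ h).exists
  unfold otherMark
  rw [dif_pos h']
  exact h'.choose_spec

theorem eq_otherMark {q : Projectivization K (HVec K d)} (hq : Marked Q⁻¹ ℓ q.rep) (hqp : q ≠ p) :
    q = otherMark Q⁻¹ ℓ p :=
  (existsUnique_other h2 hQ h).unique ⟨hq, hqp⟩ (otherMark_spec h2 hQ h)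

theorem otherMark_otherMark : otherMark Q⁻¹ ℓ (otherMark Q⁻¹ ℓ p) = p := by
  obtain ⟨h₁, h₃⟩ := otherMark_spec h2 hQ h
  exact (eq_otherMark h2 hQ h₁ h h₃.symm).symm

/-- An injective map taking marks to marks takes the other mark to the other mark. -/
theorem coReflectionP_otherMark (u : HVec K d) :
    coReflectionP Q⁻¹ u (otherMark Q⁻¹ ℓ p) =
      otherMark Q⁻¹ (reflectLine Q⁻¹ u ℓ) (coReflectionP Q⁻¹ u p) := by
  obtain ⟨h₁, h₃⟩ := otherMark_spec h2 hQ h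
  have hs := hQ.inPencil.isSymm
  exact eq_otherMark h2 hQ (marked_coReflectionP hs u h) (marked_coReflectionP hs u h₁)
    ((coReflectionP_involutive Q⁻¹ u).injective.ne h₃)

end Other

end ProjectiveMarks

/-! ### Commuting billiard maps on marked lines. -/

section MarkedLineStates

variable {K : Type*} [Field K] {d : ℕ}

open Classical in
/-- A dual quadric of the system for which the pole of the hyperplane `u` is not in `u`, if there
is one. -/
noncomputable def ConfocalSystem.pick (F : ConfocalSystem K d) (u : HVec K d) : QMat K d :=
  if h : ∃ Q, F.IsMember Q ∧ dualForm Q⁻¹ u u ≠ 0 then h.choose⁻¹ else 0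

theorem ConfocalSystem.pick_spec {F : ConfocalSystem K d} {u : HVec K d}
    (h : ∃ Q, F.IsMember Q ∧ dualForm Q⁻¹ u u ≠ 0) :
    ∃ Q, F.IsMember Q ∧ F.pick u = Q⁻¹ ∧ dualForm Q⁻¹ u u ≠ 0 := by
  refine ⟨h.choose, h.choose_spec.1, ?_, h.choose_spec.2⟩
  unfold ConfocalSystem.pick
  rw [dif_pos h]

/-- The billiard reflection of a line in the tangent hyperplane `p`. -/
noncomputable def ConfocalSystem.reflect (F : ConfocalSystem K d)
    (p : Projectivization K (HVec K d)) (ℓ : PLine K d) : PLine K d :=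
  reflectLine (F.pick p.rep) p.rep ℓ

theorem ConfocalSystem.reflect_mk {F : ConfocalSystem K d} {Q : QMat K d} (hQ : F.IsMember Q)
    {ℓ : PLine K d} {u : HVec K d} (hu : Marked Q⁻¹ ℓ u)
    (h : ∃ Q, F.IsMember Q ∧ dualForm Q⁻¹ u u ≠ 0) {D : QMat K d} (hD : F.InPencil D)
    (hc : dualForm D u u ≠ 0) :
    F.reflect (Projectivization.mk K u hu.1) ℓ = reflectLine D u ℓ := by
  obtain ⟨a, ha⟩ := Projectivization.exists_smul_eq_mk_rep K u hu.1
  obtain ⟨Q₂, hQ₂, hc₂⟩ := h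
  have hrep : ∃ Q, F.IsMember Q ∧ dualForm Q⁻¹ (Projectivization.mk K u hu.1).rep
      (Projectivization.mk K u hu.1).rep ≠ 0 := by
    refine ⟨Q₂, hQ₂, ?_⟩
    rw [← ha, Units.smul_def, dualForm_smul_left, dualForm_smul_right]
    exact mul_ne_zero a.ne_zero (mul_ne_zero a.ne_zero hc₂)
  obtain ⟨Q₃, hQ₃, e, hc₃⟩ := F.pick_spec hrep
  unfold ConfocalSystem.reflect
  rw [e]
  rw [← ha, Units.smul_def, dualForm_smul_left, dualForm_smul_right] at hc₃
  rw [← ha, Units.smul_def, reflectLine_smul _ a.ne_zero]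
  exact hu.reflectLine_eq hQ.inPencil hD hQ₃.inPencil hQ.inv_ne_zero hc
    (right_ne_zero_of_mul (right_ne_zero_of_mul hc₃))

theorem ConfocalSystem.reflect_eq {F : ConfocalSystem K d} {Q : QMat K d} (hQ : F.IsMember Q)
    {ℓ : PLine K d} {p : Projectivization K (HVec K d)} (hu : Marked Q⁻¹ ℓ p.rep)
    (h : ∃ Q, F.IsMember Q ∧ dualForm Q⁻¹ p.rep p.rep ≠ 0) {D : QMat K d} (hD : F.InPencil D)
    (hc : dualForm D p.rep p.rep ≠ 0) : F.reflect p ℓ = reflectLine D p.rep ℓ := by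
  rw [← ConfocalSystem.reflect_mk hQ hu h hD hc, Projectivization.mk_rep]

/-- A set of lines closed under reflections on the distinct quadrics `Q j`, such that these
reflections do not degenerate. -/
structure ConfocalSystem.IsRegularDomain {ι : Type*} (F : ConfocalSystem K d) (Q : ι → QMat K d)
    (G : Set (PLine K d)) : Prop where
  two_ne_zero : (2 : K) ≠ 0
  isMember : ∀ j, F.IsMember (Q j)
  distinct : ∀ i j, i ≠ j → ¬ SameQuadric (Q i) (Q j)
  regular : ∀ ℓ ∈ G, ∀ j u, Marked (Q j)⁻¹ ℓ u → ∃ Q', F.IsMember Q' ∧ dualForm Q'⁻¹ u u ≠ 0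
  closed : ∀ ℓ ∈ G, ∀ j u Q', Marked (Q j)⁻¹ ℓ u → F.IsMember Q' → dualForm Q'⁻¹ u u ≠ 0 →
    reflectLine Q'⁻¹ u ℓ ∈ G

/-- A line together with the choice of one of its two intersections with each quadric `Q j`,
given by the tangent hyperplane at this point. -/
@[ext]
structure MarkedLine {ι : Type*} (Q : ι → QMat K d) (G : Set (PLine K d)) where
  line : PLine K d
  line_mem : line ∈ G
  mark : ι → Projectivization K (HVec K d)
  marked : ∀ j, Marked (Q j)⁻¹ line (mark j).rep

namespace ConfocalSystem.IsRegularDomain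

variable {ι : Type*} {F : ConfocalSystem K d} {Q : ι → QMat K d} {G : Set (PLine K d)}
  (H : F.IsRegularDomain Q G)

include H

/-- Every other quadric of the family can thus serve to carry out the reflection at a point of `Q
i`. -/
theorem dualForm_ne_zero {ℓ : PLine K d} (hℓ : ℓ ∈ G) {i j : ι} (hij : i ≠ j) {u : HVec K d}
    (hu : Marked (Q i)⁻¹ ℓ u) : dualForm (Q j)⁻¹ u u ≠ 0 := by
  obtain ⟨Q', hQ', hc⟩ := H.regular ℓ hℓ i u hu
  exact hQ'.inPencil.dualForm_ne_zero (H.isMember i) (H.isMember j) (H.distinct i j hij) hu.2.1 hc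

theorem reflect_mk {ℓ : PLine K d} (hℓ : ℓ ∈ G) {i j : ι} (hij : i ≠ j) {u : HVec K d}
    (hu : Marked (Q i)⁻¹ ℓ u) :
    F.reflect (Projectivization.mk K u hu.1) ℓ = reflectLine (Q j)⁻¹ u ℓ :=
  F.reflect_mk (H.isMember i) hu (H.regular ℓ hℓ i u hu) (H.isMember j).inPencil
    (H.dualForm_ne_zero hℓ hij hu)

theorem reflect_eq {ℓ : PLine K d} (hℓ : ℓ ∈ G) {i j : ι} (hij : i ≠ j)
    {p : Projectivization K (HVec K d)} (hp : Marked (Q i)⁻¹ ℓ p.rep) :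
    F.reflect p ℓ = reflectLine (Q j)⁻¹ p.rep ℓ :=
  F.reflect_eq (H.isMember i) hp (H.regular ℓ hℓ i _ hp) (H.isMember j).inPencil
    (H.dualForm_ne_zero hℓ hij hp)

/-- Needed also for a family of a single quadric, where no second `Q j` is available to carry out
the reflection. -/
theorem reflect_pick {ℓ : PLine K d} (hℓ : ℓ ∈ G) {i : ι}
    {p : Projectivization K (HVec K d)} (hp : Marked (Q i)⁻¹ ℓ p.rep) :
    ∃ Q', F.IsMember Q' ∧ dualForm Q'⁻¹ p.rep p.rep ≠ 0 ∧
      F.reflect p ℓ = reflectLine Q'⁻¹ p.rep ℓ := by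
  obtain ⟨Q', hQ', e, hc⟩ := F.pick_spec (H.regular ℓ hℓ i _ hp)
  exact ⟨Q', hQ', hc, by rw [← e]; rfl⟩

theorem reflect_mem {ℓ : PLine K d} (hℓ : ℓ ∈ G) {i : ι}
    {p : Projectivization K (HVec K d)} (hp : Marked (Q i)⁻¹ ℓ p.rep) : F.reflect p ℓ ∈ G := by
  obtain ⟨Q', hQ', hc, e⟩ := H.reflect_pick hℓ hp
  rw [e]
  exact H.closed ℓ hℓ i _ Q' hp hQ' hc

theorem marked_reflect {ℓ : PLine K d} (hℓ : ℓ ∈ G) {i : ι}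
    {p : Projectivization K (HVec K d)} (hp : Marked (Q i)⁻¹ ℓ p.rep) :
    Marked (Q i)⁻¹ (F.reflect p ℓ) p.rep := by
  obtain ⟨Q', hQ', hc, e⟩ := H.reflect_pick hℓ hp
  rw [e]
  exact hp.reflectLine_self hc

/-- The reflection on `Q i` is carried out with `Q j` itself, whose homology maps points of `Q j` to
points of `Q j`. -/
theorem marked_reflect_coReflectionP {ℓ : PLine K d} (hℓ : ℓ ∈ G) {i j : ι} (hij : i ≠ j)
    {p q : Projectivization K (HVec K d)} (hp : Marked (Q i)⁻¹ ℓ p.rep)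
    (hq : Marked (Q j)⁻¹ ℓ q.rep) :
    Marked (Q j)⁻¹ (F.reflect p ℓ) (coReflectionP (Q j)⁻¹ p.rep q).rep := by
  rw [H.reflect_eq hℓ hij hp]
  exact marked_coReflectionP (H.isMember j).inPencil.isSymm _ hq

open Classical in
/-- Reflection of a marked line on the quadric `Q j` at its marked point. -/
noncomputable def bounce (j : ι) (s : MarkedLine Q G) : MarkedLine Q G where
  line := F.reflect (s.mark j) s.line
  line_mem := H.reflect_mem s.line_mem (s.marked j)
  mark k := if k = j then s.mark j else coReflectionP (Q k)⁻¹ (s.mark j).rep (s.mark k)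
  marked k := by
    by_cases h : k = j
    · subst h
      simpa using H.marked_reflect s.line_mem (s.marked k)
    · simpa [h] using H.marked_reflect_coReflectionP s.line_mem (Ne.symm h) (s.marked j) (s.marked k)

open Classical in
/-- Exchange of the marked point on the quadric `Q j` with the other point. -/
noncomputable def flip (j : ι) (s : MarkedLine Q G) : MarkedLine Q G where
  line := s.line
  line_mem := s.line_mem
  mark k := if k = j then otherMark (Q j)⁻¹ s.line (s.mark j) else s.mark k
  marked k := by
    by_cases h : k = j
    · subst h
      simpa using (otherMark_spec H.two_ne_zero (H.isMember k) (s.marked k)).1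
    · simpa [h] using s.marked k

theorem bounce_line (j : ι) (s : MarkedLine Q G) :
    (H.bounce j s).line = F.reflect (s.mark j) s.line := rfl

theorem bounce_mark_self (j : ι) (s : MarkedLine Q G) : (H.bounce j s).mark j = s.mark j :=
  if_pos rfl

theorem bounce_mark_ne {j k : ι} (h : k ≠ j) (s : MarkedLine Q G) :
    (H.bounce j s).mark k = coReflectionP (Q k)⁻¹ (s.mark j).rep (s.mark k) := if_neg h

theorem flip_line (j : ι) (s : MarkedLine Q G) : (H.flip j s).line = s.line := rfl

theorem flip_mark_self (j : ι) (s : MarkedLine Q G) :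
    (H.flip j s).mark j = otherMark (Q j)⁻¹ s.line (s.mark j) := if_pos rfl

theorem flip_mark_ne {j k : ι} (h : k ≠ j) (s : MarkedLine Q G) :
    (H.flip j s).mark k = s.mark k := if_neg h

theorem bounce_involutive (j : ι) : Function.Involutive (H.bounce j) := by
  intro s
  refine MarkedLine.ext ?_ (funext fun k => ?_)
  · rw [bounce_line, bounce_line, bounce_mark_self]
    exact reflectLine_reflectLine _ _ _
  · by_cases h : k = j
    · subst h
      rw [bounce_mark_self, bounce_mark_self]
    · rw [H.bounce_mark_ne h, H.bounce_mark_ne h, bounce_mark_self, coReflectionP_involutive]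

theorem flip_involutive (j : ι) : Function.Involutive (H.flip j) := by
  intro s
  refine MarkedLine.ext rfl (funext fun k => ?_)
  by_cases h : k = j
  · subst h
    rw [flip_mark_self, flip_mark_self, flip_line,
      otherMark_otherMark H.two_ne_zero (H.isMember k) (s.marked k)]
  · rw [H.flip_mark_ne h, H.flip_mark_ne h]

theorem flip_flip_comm {i j : ι} (hij : i ≠ j) (s : MarkedLine Q G) :
    H.flip i (H.flip j s) = H.flip j (H.flip i s) := by
  refine MarkedLine.ext rfl (funext fun k => ?_)
  by_cases hi : k = i
  · subst hi
    rw [H.flip_mark_ne hij, flip_mark_self, flip_mark_self, H.flip_mark_ne hij, flip_line]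
  · by_cases hj : k = j
    · subst hj
      rw [H.flip_mark_ne hi, flip_mark_self, flip_mark_self, H.flip_mark_ne hi, flip_line]
    · rw [H.flip_mark_ne hi, H.flip_mark_ne hj, H.flip_mark_ne hj, H.flip_mark_ne hi]

/-- Reflection on `Q j` uses only the mark on `Q j` and maps the pair of marks on `Q i` to the
corresponding pair of the new line. -/
theorem flip_bounce_comm {i j : ι} (hij : i ≠ j) (s : MarkedLine Q G) :
    H.flip i (H.bounce j s) = H.bounce j (H.flip i s) := by
  refine MarkedLine.ext ?_ (funext fun k => ?_)
  · rw [flip_line, bounce_line, bounce_line, H.flip_mark_ne hij.symm, flip_line]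
  · by_cases hi : k = i
    · subst hi
      rw [flip_mark_self, H.bounce_mark_ne hij, H.bounce_mark_ne hij, bounce_line,
        H.flip_mark_ne hij.symm, flip_mark_self,
        coReflectionP_otherMark H.two_ne_zero (H.isMember k) (s.marked k),
        H.reflect_eq s.line_mem hij.symm (s.marked j)]
    · by_cases hj : k = j
      · subst hj
        rw [H.flip_mark_ne hi, bounce_mark_self, bounce_mark_self, H.flip_mark_ne hi]
      · rw [H.flip_mark_ne hi, H.bounce_mark_ne hj, H.bounce_mark_ne hj, H.flip_mark_ne hi,
          H.flip_mark_ne hij.symm]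

theorem exists_combination {i j : ι} (hij : i ≠ j) {D : QMat K d} (hD : F.InPencil D) :
    ∃ α β : K, D = α • (Q i)⁻¹ + β • (Q j)⁻¹ :=
  (H.isMember i).inPencil.exists_combination (H.isMember j).inPencil hD (H.isMember i).inv_ne_zero
    ((H.isMember i).inv_ne_smul_inv (H.isMember j) (H.distinct i j hij))

theorem bounce_bounce_line {i j : ι} (hij : i ≠ j) (s : MarkedLine Q G) :
    (H.bounce j (H.bounce i s)).line = reflectLine (Q i)⁻¹
      (coReflection (Q j)⁻¹ (s.mark i).rep (s.mark j).rep)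
      (reflectLine (Q j)⁻¹ (s.mark i).rep s.line) := by
  have hm := (H.bounce i s).marked j
  have hG := (H.bounce i s).line_mem
  rw [bounce_line, H.reflect_eq hG hij.symm hm, bounce_line,
    H.reflect_eq s.line_mem hij (s.marked i), H.bounce_mark_ne hij.symm, coReflectionP_eq_mk]
  obtain ⟨a, ha⟩ := Projectivization.exists_smul_eq_mk_rep K _
    (coReflection_ne_zero (D := (Q j)⁻¹) (u := (s.mark i).rep) (s.mark j).rep_nonzero)
  rw [← ha, Units.smul_def, reflectLine_smul _ a.ne_zero]

theorem second_bounce_ne_zero {i j : ι} (hij : i ≠ j) (s : MarkedLine Q G) :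
    dualForm (Q i)⁻¹ (coReflection (Q j)⁻¹ (s.mark i).rep (s.mark j).rep)
      (coReflection (Q j)⁻¹ (s.mark i).rep (s.mark j).rep) ≠ 0 := by
  have hm := (H.bounce i s).marked j
  rw [H.bounce_mark_ne hij.symm, coReflectionP_eq_mk, marked_rep_mk] at hm
  exact H.dualForm_ne_zero (H.bounce i s).line_mem hij.symm hm

/-- By `coReflection_other`: the mark on `Q i` is sent to the same second tangent hyperplane of the
pencil in either order. -/
theorem bounce_bounce_mark {i j : ι} (hij : i ≠ j) (s : MarkedLine Q G) :
    (H.bounce j (H.bounce i s)).mark i = (H.bounce i (H.bounce j s)).mark i := by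
  rw [H.bounce_mark_ne hij, H.bounce_mark_ne hij.symm, bounce_mark_self, bounce_mark_self,
    H.bounce_mark_ne hij, coReflectionP_eq_mk (Q j)⁻¹, coReflectionP_rep_mk, coReflectionP_eq_mk,
    coReflectionP_eq_mk, Projectivization.mk_eq_mk_iff']
  obtain ⟨c, -, hc⟩ := coReflection_other (H.isMember i).inPencil.isSymm
    (H.isMember j).inPencil.isSymm (s.marked i).2.1 (s.marked j).2.1
    (H.dualForm_ne_zero s.line_mem hij (s.marked i))
    (H.dualForm_ne_zero s.line_mem hij.symm (s.marked j)) (H.second_bounce_ne_zero hij s)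
  exact ⟨c, hc.symm⟩

theorem bounce_bounce_comm {i j : ι} (hij : i ≠ j) (s : MarkedLine Q G) :
    H.bounce j (H.bounce i s) = H.bounce i (H.bounce j s) := by
  have hi := (H.isMember i).inPencil.isSymm
  have hj := (H.isMember j).inPencil.isSymm
  have hc := H.dualForm_ne_zero s.line_mem hij (s.marked i)
  have hb := H.dualForm_ne_zero s.line_mem hij.symm (s.marked j)
  have hv := H.second_bounce_ne_zero hij s
  refine MarkedLine.ext ?_ (funext fun k => ?_)
  · rw [H.bounce_bounce_line hij, H.bounce_bounce_line hij.symm,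
      reflectLine_pair H.two_ne_zero hi hj (s.marked i) (s.marked j) hc hb hv]
  · by_cases hki : k = i
    · subst hki
      exact H.bounce_bounce_mark hij s
    · by_cases hkj : k = j
      · subst hkj
        exact (H.bounce_bounce_mark hij.symm s).symm
      · rw [H.bounce_mark_ne hkj, H.bounce_mark_ne hki, H.bounce_mark_ne hki, H.bounce_mark_ne hkj,
          H.bounce_mark_ne hij, H.bounce_mark_ne hij.symm, coReflectionP_eq_mk (Q j)⁻¹,
          coReflectionP_eq_mk (Q i)⁻¹, coReflectionP_rep_mk, coReflectionP_rep_mk]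
        -- The third dual quadric is a combination of the other two; distinctness makes both
        -- coefficients nonzero, as `coReflection_pair` requires.
        obtain ⟨α, β, e⟩ := H.exists_combination hij (H.isMember k).inPencil
        have hα : α ≠ 0 := by
          rintro rfl
          exact (H.isMember j).inv_ne_smul_inv (H.isMember k) (H.distinct j k (Ne.symm hkj)) β
            (by rw [e]; module)
        have hβ : β ≠ 0 := by
          rintro rfl
          exact (H.isMember i).inv_ne_smul_inv (H.isMember k) (H.distinct i k (Ne.symm hki)) α
            (by rw [e]; module)
        have key := coReflection_pair H.two_ne_zero hi hj (s.marked i).2.1 (s.marked j).2.1 hc hb hv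
          hα hβ
        rw [← e] at key
        rw [← (s.mark k).mk_rep]
        simp only [coReflectionP_mk]
        rw [Projectivization.mk_eq_mk_iff']
        exact ⟨1, by rw [one_smul, key]⟩

/-- The billiard map for the quadric `Q j` on marked lines. -/
noncomputable def billiard (j : ι) : Equiv.Perm (MarkedLine Q G) :=
  (H.bounce_involutive j).toPerm.trans (H.flip_involutive j).toPerm

theorem billiard_apply (j : ι) (s : MarkedLine Q G) :
    H.billiard j s = H.flip j (H.bounce j s) := rfl

theorem commute_billiard {i j : ι} (hij : i ≠ j) : Commute (H.billiard i) (H.billiard j) := by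
  ext1 s
  rw [Equiv.Perm.mul_apply, Equiv.Perm.mul_apply]
  simp only [billiard_apply]
  rw [← H.flip_bounce_comm hij.symm, H.flip_flip_comm hij, ← H.bounce_bounce_comm hij,
    ← H.flip_bounce_comm hij]

end ConfocalSystem.IsRegularDomain

end MarkedLineStates

/-! ### The action of the lattice. -/

section LatticeAction

variable {K : Type*} [Field K] {d m : ℕ}

/-- The periods of `f` form a subgroup containing the generators. With `X = Prop` this is the
induction principle used on the lattice, in positive and negative directions at once. -/
theorem eq_of_unitVec_invariant {X : Type*} {f : (Fin m → ℤ) → X}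
    (h : ∀ n j, f (n + unitVec j) = f n) (n n' : Fin m → ℤ) : f n = f n' := by
  let S : AddSubgroup (Fin m → ℤ) :=
    { carrier := {v | ∀ n, f (n + v) = f n}
      zero_mem' := fun n => by rw [add_zero]
      add_mem' := fun {a b} ha hb n => by rw [← add_assoc, hb, ha]
      neg_mem' := fun {a} ha n => by rw [← ha (n + -a), neg_add_cancel_right] }
  have hS : ∀ v, v ∈ S := fun v => by
    rw [← Finset.univ_sum_single v]
    refine S.sum_mem fun j _ => ?_
    have : (Pi.single j (v j) : Fin m → ℤ) = v j • unitVec j := by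
      unfold unitVec
      rw [← Pi.single_smul, smul_eq_mul, mul_one]
    rw [this]
    exact S.zsmul_mem (fun n => h n j) _
  have := hS (n - n') n'
  rwa [add_sub_cancel] at this

namespace ConfocalSystem.IsRegularDomain

variable {F : ConfocalSystem K d} {Q : Fin m → QMat K d} {G : Set (PLine K d)}
  (H : F.IsRegularDomain Q G)

theorem pairwise_commute : Pairwise fun i j : Fin m => ∀ a b : Multiplicative ℤ,
    Commute (zpowersHom _ (H.billiard i) a) (zpowersHom _ (H.billiard j) b) := fun _ _ hij _ _ => by
  rw [zpowersHom_apply, zpowersHom_apply]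
  exact (H.commute_billiard hij).zpow_zpow _ _

/-- The action of the lattice on marked lines by the commuting billiard maps. -/
noncomputable def latticeHom : (Fin m → Multiplicative ℤ) →* Equiv.Perm (MarkedLine Q G) :=
  MonoidHom.noncommPiCoprod (fun j => zpowersHom _ (H.billiard j)) H.pairwise_commute

/-- The marked line that corresponds to the point `n` of the lattice. -/
noncomputable def act (n : Fin m → ℤ) (s : MarkedLine Q G) : MarkedLine Q G :=
  H.latticeHom (fun j => Multiplicative.ofAdd (n j)) s

theorem act_zero (s : MarkedLine Q G) : H.act 0 s = s := by
  change H.latticeHom 1 s = s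
  rw [map_one]
  rfl

theorem act_add_unitVec (n : Fin m → ℤ) (j : Fin m) (s : MarkedLine Q G) :
    H.act (n + unitVec j) s = H.billiard j (H.act n s) := by
  have h₁ : (fun i => Multiplicative.ofAdd ((n + unitVec j) i)) =
      Pi.mulSingle (M := fun _ => Multiplicative ℤ) j (Multiplicative.ofAdd 1) *
        fun i => Multiplicative.ofAdd (n i) := by
    funext i
    by_cases h : i = j
    · subst h
      simp only [Pi.add_apply, unitVec, Pi.single_eq_same, Pi.mul_apply, Pi.mulSingle_eq_same]
      rw [add_comm, ofAdd_add]
    · simp only [Pi.add_apply, unitVec, Pi.single_eq_of_ne h, Pi.mul_apply,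
        Pi.mulSingle_eq_of_ne h, add_zero, one_mul]
  unfold act
  rw [h₁, map_mul, Equiv.Perm.mul_apply]
  congr 1
  unfold latticeHom
  rw [MonoidHom.noncommPiCoprod_mulSingle]
  simp

/-- A function on the lattice with values in marked lines that is equivariant under unit steps is
an orbit. -/
theorem eq_act {f : (Fin m → ℤ) → MarkedLine Q G}
    (h : ∀ n j, f (n + unitVec j) = H.billiard j (f n)) (n n₀ : Fin m → ℤ) :
    f n = H.act (n - n₀) (f n₀) := by
  -- Undoing the action turns equivariance into invariance.
  let g : (Fin m → ℤ) → MarkedLine Q G := fun n =>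
    (H.latticeHom (fun j => Multiplicative.ofAdd ((n - n₀) j)))⁻¹ (f n)
  have hg : ∀ n j, g (n + unitVec j) = g n := fun n j => by
    refine (Equiv.Perm.inv_eq_iff_eq).2 ?_
    change f (n + unitVec j) = H.act (n + unitVec j - n₀) (g n)
    rw [add_sub_right_comm, act_add_unitVec, h]
    congr 1
    exact ((Equiv.Perm.inv_eq_iff_eq).1 rfl)
  have e := eq_of_unitVec_invariant hg n n₀
  have e₀ : g n₀ = f n₀ := by
    refine (Equiv.Perm.inv_eq_iff_eq).2 ?_
    rw [sub_self]
    exact (H.act_zero _).symm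
  rw [e₀] at e
  exact (Equiv.Perm.inv_eq_iff_eq).1 e

end ConfocalSystem.IsRegularDomain

end LatticeAction

/-! ### Pencils of hyperplanes and orthogonal complements. -/

section HyperplanePencils

variable {K : Type*} [Field K] {d m : ℕ}

theorem mem_polarHyperplane {Q : QMat K d} {x v : HVec K d} :
    v ∈ polarHyperplane Q x ↔ Q.mulVec x ⬝ᵥ v = 0 := Iff.rfl

theorem finrank_span_pair {u v : HVec K d} (h : LinearIndependent K ![u, v]) :
    finrank K (Submodule.span K {u, v}) = 2 := by
  have := finrank_span_eq_card h
  rwa [Matrix.range_cons_cons_empty, Fintype.card_fin] at this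

/-- The dot product as a bilinear form. -/
def dotForm : LinearMap.BilinForm K (HVec K d) := dotProductBilin K K

theorem dotForm_apply (u v : HVec K d) : dotForm u v = u ⬝ᵥ v := rfl

theorem dotForm_nondegenerate : (dotForm : LinearMap.BilinForm K (HVec K d)).Nondegenerate := by
  refine ⟨fun x h => dotProduct_eq_zero x h, fun y h => dotProduct_eq_zero y fun x => ?_⟩
  rw [dotProduct_comm]
  exact h x

theorem dotForm_isRefl : (dotForm : LinearMap.BilinForm K (HVec K d)).IsRefl := by
  intro x y h
  rw [dotForm_apply] at h ⊢
  rwa [dotProduct_comm]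

theorem mem_orthogonal_span_pair {u v w : HVec K d} :
    w ∈ LinearMap.BilinForm.orthogonal dotForm (Submodule.span K {u, v}) ↔
      u ⬝ᵥ w = 0 ∧ v ⬝ᵥ w = 0 := by
  rw [LinearMap.BilinForm.mem_orthogonal_iff]
  constructor
  · intro h
    exact ⟨h u (Submodule.subset_span (by simp)), h v (Submodule.subset_span (by simp))⟩
  · rintro ⟨hu, hv⟩ x hx
    obtain ⟨a, b, rfl⟩ := Submodule.mem_span_pair.1 hx
    change (a • u + b • v) ⬝ᵥ w = 0
    simp [hu, hv]

theorem finrank_orthogonal_span_pair {u v : HVec K d} (h : LinearIndependent K ![u, v]) :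
    finrank K (LinearMap.BilinForm.orthogonal dotForm (Submodule.span K {u, v})) + 2 =
      d + 1 := by
  have h₁ := LinearMap.BilinForm.finrank_orthogonal dotForm_nondegenerate
    (Submodule.span K {u, v})
  have h₂ := Submodule.finrank_le (Submodule.span K {u, v})
  rw [finrank_span_pair h, finrank_fin_fun] at h₁ h₂
  rw [h₁]
  omega

/-- A hyperplane that contains the intersection of two others is in their pencil. -/
theorem mem_span_pair_of_orthogonal {u v w : HVec K d} (h : LinearIndependent K ![u, v])
    {W : Submodule K (HVec K d)} (hW : finrank K W + 2 = d + 1) (hu : ∀ y ∈ W, u ⬝ᵥ y = 0)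
    (hv : ∀ y ∈ W, v ⬝ᵥ y = 0) (hw : ∀ y ∈ W, w ⬝ᵥ y = 0) :
    ∃ a b : K, w = a • u + b • v := by
  have hle : W ≤ LinearMap.BilinForm.orthogonal dotForm (Submodule.span K {u, v}) :=
    fun y hy => mem_orthogonal_span_pair.2 ⟨hu y hy, hv y hy⟩
  -- By dimension `W` is the whole complement of the pencil, so the double complement returns the
  -- pencil.
  have he := Submodule.eq_of_le_of_finrank_eq hle (Nat.add_right_cancel (hW.trans (finrank_orthogonal_span_pair h).symm))
  have hw' : w ∈ LinearMap.BilinForm.orthogonal dotForm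
      (LinearMap.BilinForm.orthogonal dotForm (Submodule.span K {u, v})) := by
    rw [LinearMap.BilinForm.mem_orthogonal_iff]
    intro y hy
    rw [← he] at hy
    change y ⬝ᵥ w = 0
    rw [dotProduct_comm, hw y hy]
  rw [LinearMap.BilinForm.orthogonal_orthogonal dotForm_nondegenerate
    dotForm_isRefl] at hw'
  obtain ⟨a, b, hab⟩ := Submodule.mem_span_pair.1 hw'
  exact ⟨a, b, hab.symm⟩

end HyperplanePencils

/-! ### Reflection preserves the caustics. -/

section TangentLines

variable {K : Type*} [Field K] {d m : ℕ}

/-- If the line were tangent at `x`, polarity would give `u ⬝ᵥ x = 0`. As `u` cuts the transversal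
line in one point, `x` would be the marked point, whose tangent hyperplane does not contain the
line. -/
theorem Touches.not_marked {Q C : QMat K d} (hQ : Q.IsSymm) (hu : IsUnit Q.det) {ℓ : PLine K d}
    (h : Touches C ℓ) (hs : SameQuadric Q C) {u : HVec K d} : ¬ Marked Q⁻¹ ℓ u := by
  rintro ⟨h0, h1, h3, w, hw, h4⟩
  obtain ⟨x, hx, ⟨hx0, -⟩, hℓ⟩ := h
  obtain ⟨c, hc, rfl⟩ := hs
  have hpol : ∀ v ∈ ℓ.1, Q.mulVec x ⬝ᵥ v = 0 := fun v hv => by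
    have := hℓ hv
    rw [mem_polarHyperplane, Matrix.smul_mulVec, smul_dotProduct, smul_eq_mul] at this
    exact (mul_eq_zero.1 this).resolve_left hc
  have hQu : Q.mulVec (Q⁻¹.mulVec u) = u := by
    rw [Matrix.mulVec_mulVec, Matrix.mul_nonsing_inv _ hu, Matrix.one_mulVec]
  have hux : u ⬝ᵥ x = 0 := by
    have h := hpol _ h3
    rw [dotProduct_comm] at h
    change dualForm Q _ x = 0 at h
    rw [dualForm_comm hQ] at h
    change x ⬝ᵥ Q.mulVec (Q⁻¹.mulVec u) = 0 at h
    rwa [hQu, dotProduct_comm] at h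
  have := h3
  rw [PLine.eq_span hx hw (independent_of_dotProduct hx0 hux h4)] at this
  obtain ⟨α, β, hab⟩ := Submodule.mem_span_pair.1 this
  have h1' : u ⬝ᵥ Q⁻¹.mulVec u = 0 := h1
  have hβ : β = 0 := by
    rw [← hab] at h1'
    simpa [hux, h4] using h1'
  apply h4
  rw [← hQu, ← hab, hβ, zero_smul, add_zero, Matrix.mulVec_smul, smul_dotProduct, hpol w hw,
    smul_zero]

/-- A line reflected on `Q` is transversal to it, so the caustic `C` differs from `Q` and can itself
carry out the reflection. Its homology preserves `C` and hence tangency to it. -/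
theorem Touches.reflects {F : ConfocalSystem K d} {Q C : QMat K d} (hQ : F.IsMember Q)
    (hC : F.IsMember C) {ℓ ℓ' : PLine K d} (h : Touches C ℓ) {x : HVec K d}
    (hr : F.Reflects Q x ℓ ℓ') : Touches C ℓ' := by
  obtain ⟨hu, Q₂, hQ₂, hc, rfl⟩ := hr.marked hQ
  have hne : ¬ SameQuadric Q C := fun hs => h.not_marked hQ.1 hQ.2.1 hs hu
  set u := Q.mulVec x
  have hc' := hQ₂.inPencil.dualForm_ne_zero hQ hC hne hu.2.1 hc
  rw [← hu.reflectLine_eq hQ.inPencil hQ₂.inPencil hC.inPencil hQ.inv_ne_zero hc hc']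
  obtain ⟨y, hy, ⟨hy0, hy1⟩, hℓ⟩ := h
  have hCy : C.mulVec (poleReflection C⁻¹ u y) = coReflection C⁻¹ u (C.mulVec y) := by
    apply hC.inv_mulVec_injective
    rw [hC.inv_mulVec_mulVec, mulVec_coReflection, hC.inv_mulVec_mulVec]
  have hs := hC.inPencil.isSymm
  refine ⟨poleReflection C⁻¹ u y, Submodule.mem_map_of_mem hy, ⟨?_, ?_⟩, ?_⟩
  · rwa [Ne, map_eq_zero_iff _ (poleReflection_involutive C⁻¹ u).injective]
  · rw [hCy, dotProduct_comm, coReflection_dotProduct_poleReflection hs, dotProduct_comm]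
    exact hy1
  · rintro _ ⟨v, hv, rfl⟩
    rw [mem_polarHyperplane, hCy, coReflection_dotProduct_poleReflection hs]
    exact hℓ hv

end TangentLines

/-! ### Orbits are double reflection nets. -/

section OrbitNet

variable {K : Type*} [Field K] {d m : ℕ} {F : ConfocalSystem K d} {Q : Fin m → QMat K d}
  {G : Set (PLine K d)}

/-- The marked point of a marked line on the quadric `Q j`. -/
noncomputable def MarkedLine.point {ι : Type*} {Q : ι → QMat K d} (s : MarkedLine Q G) (j : ι) :
    HVec K d := (Q j)⁻¹.mulVec (s.mark j).rep

namespace ConfocalSystem.IsRegularDomain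

theorem billiard_line (H : F.IsRegularDomain Q G) (j : Fin m) (s : MarkedLine Q G) :
    (H.billiard j s).line = F.reflect (s.mark j) s.line := rfl

theorem billiard_mark_ne (H : F.IsRegularDomain Q G) {j k : Fin m} (h : k ≠ j)
    (s : MarkedLine Q G) :
    (H.billiard j s).mark k = coReflectionP (Q k)⁻¹ (s.mark j).rep (s.mark k) := by
  rw [billiard_apply, H.flip_mark_ne h, H.bounce_mark_ne h]

theorem billiard_mark_self (H : F.IsRegularDomain Q G) (j : Fin m) (s : MarkedLine Q G) :
    (H.billiard j s).mark j =
      otherMark (Q j)⁻¹ (F.reflect (s.mark j) s.line) (s.mark j) := by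
  rw [billiard_apply, flip_mark_self, bounce_mark_self, bounce_line]

theorem reflects_billiard (hd : 2 ≤ d) (H : F.IsRegularDomain Q G) (j : Fin m)
    (s : MarkedLine Q G) : F.Reflects (Q j) (s.point j) s.line (H.billiard j s).line := by
  obtain ⟨Q', hQ', hc, e⟩ := H.reflect_pick s.line_mem (s.marked j)
  rw [billiard_line, e]
  exact ConfocalSystem.reflects_of_marked hd (H.isMember j) hQ' (s.marked j) hc

theorem point_independent (H : F.IsRegularDomain Q G) (j : Fin m) (s : MarkedLine Q G) :
    LinearIndependent K ![s.point j, (H.billiard j s).point j] := by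
  refine mulVec_independent (H.isMember j) ?_
  rw [Projectivization.linearIndependent_pair_iff_ne, billiard_mark_self]
  exact (otherMark_spec H.two_ne_zero (H.isMember j)
    (H.marked_reflect s.line_mem (s.marked j))).2.symm

theorem mark_independent (H : F.IsRegularDomain Q G) {i j : Fin m} (hij : i ≠ j)
    (s : MarkedLine Q G) : LinearIndependent K ![(s.mark i).rep, (s.mark j).rep] := by
  rw [LinearIndependent.pair_iff' (s.mark i).rep_nonzero]
  intro a ha
  apply H.dualForm_ne_zero s.line_mem hij.symm (s.marked j)
  rw [← ha, dualForm_smul_left, dualForm_smul_right, (s.marked i).2.1]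
  ring

/-- `coReflection` changes a covector only by a multiple of the mirror covector; this is the source
of the pencil condition. -/
theorem billiard_mark_mem_span (H : F.IsRegularDomain Q G) {i j : Fin m} (hij : i ≠ j)
    (s : MarkedLine Q G) : ∃ a b : K,
      ((H.billiard j s).mark i).rep = a • (s.mark i).rep + b • (s.mark j).rep := by
  rw [H.billiard_mark_ne hij, coReflectionP_eq_mk]
  obtain ⟨a, ha⟩ := Projectivization.exists_smul_eq_mk_rep K _
    (coReflection_ne_zero (D := (Q i)⁻¹) (u := (s.mark j).rep) (s.mark i).rep_nonzero)
  rw [← ha, coReflection_apply, Units.smul_def]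
  exact ⟨_, _, by rw [smul_sub, smul_smul, sub_eq_add_neg, ← neg_smul]⟩

theorem polarHyperplane_point (H : F.IsRegularDomain Q G) (j : Fin m) (s : MarkedLine Q G)
    (v : HVec K d) : v ∈ polarHyperplane (Q j) (s.point j) ↔ (s.mark j).rep ⬝ᵥ v = 0 := by
  rw [mem_polarHyperplane, MarkedLine.point, (H.isMember j).mulVec_inv_mulVec]

theorem pencil_billiard (H : F.IsRegularDomain Q G) {i j : Fin m} (hij : i ≠ j)
    (s : MarkedLine Q G) : ∃ W : Submodule K (HVec K d), finrank K W + 2 = d + 1 ∧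
      W ≤ polarHyperplane (Q i) (s.point i) ∧
      W ≤ polarHyperplane (Q i) ((H.billiard j s).point i) ∧
      W ≤ polarHyperplane (Q j) (s.point j) ∧
      W ≤ polarHyperplane (Q j) ((H.billiard i s).point j) := by
  refine ⟨_, finrank_orthogonal_span_pair (H.mark_independent hij s), ?_, ?_, ?_, ?_⟩ <;>
    intro v hv <;> rw [mem_orthogonal_span_pair] at hv <;> rw [H.polarHyperplane_point]
  · exact hv.1
  · obtain ⟨a, b, e⟩ := H.billiard_mark_mem_span hij s
    rw [e]
    simp [hv.1, hv.2]
  · exact hv.2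
  · obtain ⟨a, b, e⟩ := H.billiard_mark_mem_span hij.symm s
    rw [e]
    simp [hv.1, hv.2]

theorem touches_act (hd : 2 ≤ d) (H : F.IsRegularDomain Q G) {C : QMat K d} (hC : F.IsMember C)
    (s : MarkedLine Q G) (hs : Touches C s.line) (n : Fin m → ℤ) : Touches C (H.act n s).line := by
  have h := eq_of_unitVec_invariant (f := fun n => Touches C (H.act n s).line)
    (fun n j => by
      rw [H.act_add_unitVec]
      have hr := H.reflects_billiard hd j (H.act n s)
      exact propext ⟨fun h => h.reflects (H.isMember j) hC hr.symm,
        fun h => h.reflects (H.isMember j) hC hr⟩) n 0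
  rw [h]
  rwa [H.act_zero]

/-- The orbit of a marked line is a double reflection net. -/
theorem isDoubleReflectionNet_act (hd : 2 ≤ d) (H : F.IsRegularDomain Q G)
    {C : Fin (d - 1) → QMat K d} (hC : ∀ a, F.IsMember (C a)) (s : MarkedLine Q G)
    (hs : s.line ∈ tangentLines C) (n₀ : Fin m → ℤ) :
    F.IsDoubleReflectionNet C Q fun n => (H.act (n - n₀) s).line := by
  have step : ∀ n j, H.act (n + unitVec j - n₀) s = H.billiard j (H.act (n - n₀) s) :=
    fun n j => by rw [add_sub_right_comm, H.act_add_unitVec]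
  refine ⟨H.isMember, fun n a => H.touches_act hd (hC a) s (hs a) _,
    fun j n => (H.act (n - n₀) s).point j, ?_, ?_⟩
  · intro j n k
    have e : n + (k + 1) • unitVec j = n + k • unitVec j + unitVec j := by
      rw [add_smul, one_smul, add_assoc]
    simp only [e, step]
    exact ⟨H.reflects_billiard hd j _, H.point_independent j _⟩
  · intro i j n hij
    have hcomm : H.billiard j (H.billiard i (H.act (n - n₀) s)) =
        H.billiard i (H.billiard j (H.act (n - n₀) s)) :=
      congrArg (fun e : Equiv.Perm _ => e (H.act (n - n₀) s)) (H.commute_billiard hij.symm).eq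
    simp only [step]
    refine ⟨H.reflects_billiard hd i _, ?_, H.reflects_billiard hd j _,
      H.reflects_billiard hd j _, H.pencil_billiard hij _⟩
    rw [hcomm]
    exact H.reflects_billiard hd i _

end ConfocalSystem.IsRegularDomain

end OrbitNet

/-! ### Lines fixed by all reflections. -/

section CommonNormals

variable {K : Type*} [Field K] {d m : ℕ}

/-- The line is the common normal of the quadrics of the system at its points. -/
def ConfocalSystem.IsAxis (F : ConfocalSystem K d) (ℓ : PLine K d) : Prop :=
  ∃ u v : HVec K d, LinearIndependent K ![u, v] ∧
    ∀ D, F.InPencil D → D.mulVec u ∈ ℓ.1 ∧ D.mulVec v ∈ ℓ.1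

theorem reflectLine_eq_self {D : QMat K d} {u : HVec K d} {ℓ : PLine K d}
    (h : D.mulVec u ∈ ℓ.1) : reflectLine D u ℓ = ℓ := by
  ext w
  rw [mem_reflectLine, poleReflection_apply]
  exact ℓ.1.sub_mem_iff_left (ℓ.1.smul_mem _ h)

/-- The tangent covector at any point of the axis is a combination of the two given ones, so its
pole lies on the axis and the homology fixes the line. -/
theorem ConfocalSystem.IsAxis.reflects {F : ConfocalSystem K d} {Q : QMat K d}
    (hQ : F.IsMember Q) {ℓ ℓ' : PLine K d} (h : F.IsAxis ℓ) {x : HVec K d}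
    (hr : F.Reflects Q x ℓ ℓ') : ℓ' = ℓ := by
  obtain ⟨hu, Q₂, hQ₂, -, rfl⟩ := hr.marked hQ
  obtain ⟨v, w, hvw, hD⟩ := h
  obtain ⟨hv, hw⟩ := hD _ hQ.inPencil
  obtain ⟨α, β, e⟩ := Marked.eq_combination hQ hv hw hvw hu.2.2.1
  obtain ⟨hv, hw⟩ := hD _ hQ₂.inPencil
  apply reflectLine_eq_self
  rw [e, Matrix.mulVec_add, Matrix.mulVec_smul, Matrix.mulVec_smul]
  exact ℓ.1.add_mem (ℓ.1.smul_mem _ hv) (ℓ.1.smul_mem _ hw)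

/-- For `w` on the fixed line, the difference of `w` and its image is a nonzero multiple of the
pole, so the pole is on the line. With the point of reflection it yields all `D u`. -/
theorem ConfocalSystem.Reflects.mulVec_mem (h2 : (2 : K) ≠ 0) {F : ConfocalSystem K d}
    {Q : QMat K d} (hQ : F.IsMember Q) {ℓ : PLine K d} {x : HVec K d} (hr : F.Reflects Q x ℓ ℓ)
    {D : QMat K d} (hD : F.InPencil D) : D.mulVec (Q.mulVec x) ∈ ℓ.1 := by
  obtain ⟨hu, Q₂, hQ₂, hc, e⟩ := hr.marked hQ
  obtain ⟨-, h1, h3, w, hw, h4⟩ := hu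
  have hw' : poleReflection Q₂⁻¹ (Q.mulVec x) w ∈ ℓ.1 := by
    rw [← mem_reflectLine, ← e]
    exact hw
  have hmem := ℓ.1.sub_mem hw hw'
  rw [poleReflection_apply, sub_sub_cancel] at hmem
  have hcoef : 2 / dualForm Q₂⁻¹ (Q.mulVec x) (Q.mulVec x) * (Q.mulVec x ⬝ᵥ w) ≠ 0 :=
    mul_ne_zero (div_ne_zero h2 hc) h4
  have h₂ := (ℓ.1.smul_mem_iff hcoef).1 hmem
  obtain ⟨α, β, rfl, -⟩ := hQ.inPencil.exists_combination_of_dualForm hQ₂.inPencil hD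
    hQ.inv_ne_zero h1 hc
  rw [Matrix.add_mulVec, Matrix.smul_mulVec, Matrix.smul_mulVec]
  exact ℓ.1.add_mem (ℓ.1.smul_mem _ h3) (ℓ.1.smul_mem _ h₂)

/-- Outside the common normals, the point of reflection is determined by the two lines. -/
theorem ConfocalSystem.Reflects.not_independent (h2 : (2 : K) ≠ 0) {F : ConfocalSystem K d}
    {Q : QMat K d} (hQ : F.IsMember Q) {ℓ ℓ' : PLine K d} (hℓ : ¬ F.IsAxis ℓ) {x x' : HVec K d}
    (h : F.Reflects Q x ℓ ℓ') (h' : F.Reflects Q x' ℓ ℓ') :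
    ¬ LinearIndependent K ![Q.mulVec x, Q.mulVec x'] := by
  intro hi
  have e : ℓ = ℓ' := PLine.eq_of_mem (h.marked hQ).1.2.2.1 (h'.marked hQ).1.2.2.1
    (h.symm.marked hQ).1.2.2.1 (h'.symm.marked hQ).1.2.2.1 (mulVec_independent hQ hi)
  subst e
  exact hℓ ⟨_, _, hi, fun D hD => ⟨h.mulVec_mem h2 hQ hD, h'.mulVec_mem h2 hQ hD⟩⟩

theorem Projectivization.mk_eq_mk_of_not_independent {u v : HVec K d} (hu : u ≠ 0) (hv : v ≠ 0)
    (h : ¬ LinearIndependent K ![u, v]) :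
    Projectivization.mk K v hv = Projectivization.mk K u hu := by
  rw [LinearIndependent.pair_iff' hu] at h
  push Not at h
  exact (Projectivization.mk_eq_mk_iff' K v u hv hu).2 h

namespace ConfocalSystem.IsRegularDomain

variable {ι : Type*} {F : ConfocalSystem K d} {Q : ι → QMat K d} {G : Set (PLine K d)}
  (H : F.IsRegularDomain Q G)

include H

theorem reflects_mem {ℓ ℓ' : PLine K d} (hℓ : ℓ ∈ G) {j : ι} {x : HVec K d}
    (h : F.Reflects (Q j) x ℓ ℓ') : ℓ' ∈ G := by
  obtain ⟨hu, Q₂, hQ₂, hc, rfl⟩ := h.marked (H.isMember j)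
  exact H.closed ℓ hℓ j _ Q₂ hu hQ₂ hc

theorem reflect_of_reflects {ℓ ℓ' : PLine K d} {j : ι} {x : HVec K d}
    (h : F.Reflects (Q j) x ℓ ℓ') (hx : (Q j).mulVec x ≠ 0) :
    F.reflect (Projectivization.mk K ((Q j).mulVec x) hx) ℓ = ℓ' := by
  obtain ⟨hu, Q₂, hQ₂, hc, rfl⟩ := h.marked (H.isMember j)
  exact F.reflect_mk (H.isMember j) hu ⟨Q₂, hQ₂, hc⟩ hQ₂.inPencil hc

theorem reflectLine_of_reflects {ℓ ℓ' : PLine K d} (hℓ : ℓ ∈ G) {i j : ι} (hij : i ≠ j)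
    {x : HVec K d} (h : F.Reflects (Q i) x ℓ ℓ') :
    reflectLine (Q j)⁻¹ ((Q i).mulVec x) ℓ = ℓ' := by
  have hu := (h.marked (H.isMember i)).1
  rw [← H.reflect_mk hℓ hij hu, H.reflect_of_reflects h]

/-- Outside the common normals, three lines of a double reflection configuration determine the
fourth point. -/
theorem configuration_not_independent {i j : ι} (hij : i ≠ j) {x₁ x₂ y₁ y₂ : HVec K d}
    {ℓ ℓ₁ ℓ₂ ℓ₁₂ : PLine K d} (hℓ : ℓ ∈ G) (hax : ¬ F.IsAxis ℓ)
    (h : F.IsDoubleReflectionConfiguration (Q i) (Q j) x₁ x₂ y₁ y₂ ℓ ℓ₁ ℓ₂ ℓ₁₂) :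
    ¬ LinearIndependent K
      ![coReflection (Q i)⁻¹ ((Q j).mulVec y₁) ((Q i).mulVec x₁), (Q i).mulVec x₂] := by
  intro hi
  obtain ⟨hx₁, hx₂, hy₁, hy₂, W, hW, hW₁, hW₂, hW₃, hW₄⟩ := h
  have hQi := H.isMember i
  have hQj := H.isMember j
  have h2 := H.two_ne_zero
  have hs := hQi.inPencil.isSymm
  have hℓ₁ := H.reflects_mem hℓ hx₁
  have hℓ₂ := H.reflects_mem hℓ hy₁
  have hmu := (hx₁.marked hQi).1
  have hmv := (hy₁.marked hQj).1
  have hmu₂ := (hx₂.marked hQi).1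
  have hmv₂ := (hy₂.marked hQj).1
  have hb := H.dualForm_ne_zero hℓ hij.symm hmv
  have hv₂ := H.dualForm_ne_zero hℓ₁ hij.symm hmv₂
  have hr₁ := H.reflectLine_of_reflects hℓ hij hx₁
  have hr₂ := H.reflectLine_of_reflects hℓ hij.symm hy₁
  have hr₃ := H.reflectLine_of_reflects hℓ₂ hij hx₂
  set u := (Q i).mulVec x₁ with hu
  set v := (Q j).mulVec y₁ with hv
  have huv : LinearIndependent K ![u, v] := by
    rw [LinearIndependent.pair_iff' hmu.1]
    rintro a ha
    rw [← ha, dualForm_smul_left, dualForm_smul_right, hmu.2.1] at hb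
    simp at hb
  obtain ⟨α, β, hu₂⟩ := mem_span_pair_of_orthogonal huv hW hW₁ hW₃ hW₂
  obtain ⟨α', β', hv₂'⟩ := mem_span_pair_of_orthogonal huv hW hW₁ hW₃ hW₄
  have hmstar := hmu.coReflection hs v
  rw [hr₂] at hmstar
  -- the tangent hyperplane at `x₂` is the one at `x₁`
  have hβ : β = 0 := by
    by_contra hβ
    have h0 := hmu₂.2.1
    rw [hu₂] at h0
    simp only [dualForm_add_left, dualForm_add_right, dualForm_smul_left, dualForm_smul_right,
      hmu.2.1, dualForm_comm hs u v] at h0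
    have h1 : 2 * α * dualForm (Q i)⁻¹ v u + β * dualForm (Q i)⁻¹ v v = 0 := by
      refine (mul_eq_zero.1 (?_ : β * _ = 0)).resolve_left hβ
      linear_combination h0
    rw [LinearIndependent.pair_iff' hmstar.1] at hi
    refine hi α ?_
    rw [hu₂, coReflection_apply]
    match_scalars
    · ring
    · field_simp
      linear_combination -h1
  rw [hβ, zero_smul, add_zero] at hu₂
  have hα : α ≠ 0 := by
    rintro rfl
    exact hmu₂.1 (by rw [hu₂, zero_smul])
  have hu_mem : (Q i)⁻¹.mulVec u ∈ ℓ₂.1 := by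
    have := hmu₂.2.2.1
    rw [hu₂, Matrix.mulVec_smul] at this
    exact (ℓ₂.1.smul_mem_iff hα).1 this
  -- `ℓ₂` contains the points of both `u` and its image `u - k v`; independence from `u₂`, a
  -- multiple of `u`, forces `k ≠ 0`.
  have hv_mem : (Q i)⁻¹.mulVec v ∈ ℓ₂.1 := by
    have hmem := ℓ₂.1.sub_mem hu_mem hmstar.2.2.1
    rw [coReflection_apply, Matrix.mulVec_sub, Matrix.mulVec_smul, sub_sub_cancel] at hmem
    refine (ℓ₂.1.smul_mem_iff ?_).1 hmem
    intro h0
    rw [LinearIndependent.pair_iff' hmstar.1] at hi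
    refine hi α ?_
    rw [hu₂, coReflection_apply, h0, zero_smul, sub_zero]
  -- The pole of `v` with respect to `Q i` lies on `ℓ₂`, so reflection in `v` fixes `ℓ₂`.
  have e₂ : ℓ₂ = ℓ := by
    rw [← reflectLine_reflectLine (Q i)⁻¹ v ℓ, hr₂, reflectLine_eq_self hv_mem]
  subst e₂
  have e₃ : ℓ₁₂ = ℓ₁ := by
    rw [← hr₃, ← hr₁, hu₂, reflectLine_smul _ hα]
  subst e₃
  -- Now `Q j` reflects `ℓ₁₂` to itself at `y₂`. This puts the pole of `v` on `ℓ₁₂` too, so all four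
  -- lines coincide in a line fixed by the reflections in both `u` and `v`, which is an axis.
  have hv₂_mem := hy₂.mulVec_mem h2 hQj hQi.inPencil
  have hβ' : β' ≠ 0 := by
    rintro rfl
    rw [hv₂', zero_smul, add_zero, dualForm_smul_left, dualForm_smul_right, hmu.2.1] at hv₂
    simp at hv₂
  have hu_mem₁ : (Q i)⁻¹.mulVec u ∈ ℓ₁₂.1 := (hx₁.symm.marked hQi).1.2.2.1
  have hv_mem₁ : (Q i)⁻¹.mulVec v ∈ ℓ₁₂.1 := by
    rw [hv₂', Matrix.mulVec_add, Matrix.mulVec_smul, Matrix.mulVec_smul] at hv₂_mem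
    exact (ℓ₁₂.1.smul_mem_iff hβ').1
      ((ℓ₁₂.1.add_mem_iff_right (ℓ₁₂.1.smul_mem _ hu_mem₁)).1 hv₂_mem)
  have e₁ : ℓ₁₂ = ℓ₂ :=
    PLine.eq_of_mem hu_mem₁ hv_mem₁ hu_mem hv_mem (mulVec_independent hQi huv)
  subst e₁
  exact hax ⟨u, v, huv, fun D hD => ⟨hx₁.mulVec_mem h2 hQi hD, hy₁.mulVec_mem h2 hQj hD⟩⟩

end ConfocalSystem.IsRegularDomain

end CommonNormals

/-! ### Every net is an orbit. -/

section NetsAreOrbits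

variable {K : Type*} [Field K] {d m : ℕ} {F : ConfocalSystem K d} {Q : Fin m → QMat K d}
  {G : Set (PLine K d)}

theorem mulVec_independent' {F : ConfocalSystem K d} {Q : QMat K d} (hQ : F.IsMember Q)
    {x y : HVec K d} (h : LinearIndependent K ![x, y]) :
    LinearIndependent K ![Q.mulVec x, Q.mulVec y] := by
  rw [LinearIndependent.pair_iff] at h ⊢
  intro s t hst
  refine h s t ?_
  rw [← Matrix.mulVec_smul, ← Matrix.mulVec_smul, ← Matrix.mulVec_add] at hst
  rw [← hQ.inv_mulVec_mulVec (s • x + t • y), hst, Matrix.mulVec_zero]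

/-- A double reflection net is the orbit of a marked line. -/
theorem ConfocalSystem.IsDoubleReflectionNet.eq_act (hd : 2 ≤ d) (H : F.IsRegularDomain Q G)
    {C : Fin (d - 1) → QMat K d} {ψ : (Fin m → ℤ) → PLine K d}
    (hψ : F.IsDoubleReflectionNet C Q ψ) {n₀ : Fin m → ℤ} (s : MarkedLine Q G)
    (hs : s.line = ψ n₀)
    (hr : ∀ j, F.Reflects (Q j) (s.point j) (ψ n₀) (ψ (n₀ + unitVec j))) (n : Fin m → ℤ) :
    ψ n = (H.act (n - n₀) s).line := by
  obtain ⟨hQ, -, P, hP, hconf⟩ := hψ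
  have h2 := H.two_ne_zero
  have hrefl : ∀ n j, F.Reflects (Q j) (P j n) (ψ n) (ψ (n + unitVec j)) := fun n j => by
    have := (hP j n 0).1
    simpa using this
  have hind : ∀ n j, LinearIndependent K ![P j n, P j (n + unitVec j)] := fun n j => by
    have := (hP j n 0).2
    simpa using this
  have hG : ∀ n, ψ n ∈ G := fun n => by
    have := eq_of_unitVec_invariant (f := fun n => ψ n ∈ G) (fun n j =>
      propext ⟨fun h => H.reflects_mem h (hrefl n j).symm, fun h => H.reflects_mem h (hrefl n j)⟩)
      n n₀
    rw [this, ← hs]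
    exact s.line_mem
  -- On an axis the lines do not determine the points of reflection, so marks cannot be compared.
  -- Both the net and the orbit are constant there.
  by_cases hax : F.IsAxis (ψ n₀)
  · have h₁ := eq_of_unitVec_invariant (f := fun n => ψ n = ψ n₀) (fun n j => by
      refine propext ⟨fun h => ?_, fun h => ?_⟩
      · have hr := (hrefl n j).symm
        rw [h] at hr
        exact hax.reflects (hQ j) hr
      · have hr := hrefl n j
        rw [h] at hr
        exact hax.reflects (hQ j) hr) n n₀
    have h₂ := eq_of_unitVec_invariant (f := fun n => (H.act (n - n₀) s).line = ψ n₀)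
      (fun n j => by
        have hr := H.reflects_billiard hd j (H.act (n - n₀) s)
        rw [← H.act_add_unitVec, ← add_sub_right_comm] at hr
        refine propext ⟨fun h => ?_, fun h => ?_⟩
        · have hr := hr.symm
          rw [h] at hr
          exact hax.reflects (hQ j) hr
        · rw [h] at hr
          exact hax.reflects (hQ j) hr) n n₀
    simp only [sub_self, H.act_zero, hs] at h₁ h₂
    rw [of_eq_true h₁, of_eq_true h₂]
  · have hnax : ∀ n, ¬ F.IsAxis (ψ n) := fun n => by
      have := eq_of_unitVec_invariant (f := fun n => F.IsAxis (ψ n)) (fun n j => by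
        refine propext ⟨fun h => ?_, fun h => ?_⟩
        · rwa [h.reflects (hQ j) (hrefl n j).symm]
        · rwa [h.reflects (hQ j) (hrefl n j)]) n n₀
      rwa [this]
    have hm : ∀ n j, Marked (Q j)⁻¹ (ψ n) ((Q j).mulVec (P j n)) := fun n j =>
      ((hrefl n j).marked (hQ j)).1
    let f : (Fin m → ℤ) → MarkedLine Q G := fun n =>
      { line := ψ n
        line_mem := hG n
        mark := fun j => Projectivization.mk K ((Q j).mulVec (P j n)) (hm n j).1
        marked := fun j => (marked_rep_mk _).2 (hm n j) }
    -- The line and the mark on `Q j` follow from the billiard condition, the marks on the other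
    -- quadrics from the pencil condition of the double reflection configuration.
    have hf : ∀ n j, f (n + unitVec j) = H.billiard j (f n) := fun n j => by
      refine MarkedLine.ext ?_ (funext fun k => ?_)
      · exact (H.reflect_of_reflects (hrefl n j) _).symm
      · by_cases hkj : k = j
        · subst hkj
          rw [H.billiard_mark_self]
          have hl : F.reflect ((f n).mark k) (f n).line = ψ (n + unitVec k) :=
            H.reflect_of_reflects (hrefl n k) _
          have hm' := H.marked_reflect (f n).line_mem ((f n).marked k)
          refine eq_otherMark h2 (hQ k) hm' ?_ ?_
          · rw [hl]
            exact (f (n + unitVec k)).marked k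
          · exact Projectivization.mk_ne_mk_of_independent _ _
              (mulVec_independent' (hQ k) (hind n k))
        · rw [H.billiard_mark_ne hkj]
          change Projectivization.mk K ((Q k).mulVec (P k (n + unitVec j))) _ =
            coReflectionP (Q k)⁻¹ (Projectivization.mk K ((Q j).mulVec (P j n)) _).rep
              (Projectivization.mk K ((Q k).mulVec (P k n)) _)
          rw [coReflectionP_rep_mk, coReflectionP_mk]
          exact Projectivization.mk_eq_mk_of_not_independent _ _
            (H.configuration_not_independent hkj (hG n) (hnax n) (hconf k j n hkj))
    have h₀ : f n₀ = s := by
      refine MarkedLine.ext hs.symm (funext fun j => ?_)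
      rw [← (s.mark j).mk_rep]
      refine Projectivization.mk_eq_mk_of_not_independent _ _ ?_
      have := (hr j).not_independent h2 (hQ j) hax (hrefl n₀ j)
      rwa [MarkedLine.point, (hQ j).mulVec_inv_mulVec] at this
    have := H.eq_act hf n n₀
    rw [h₀] at this
    rw [← this]

end NetsAreOrbits

/-! ### Passing to a subfamily of quadrics. -/

section Restriction

variable {K : Type*} [Field K] {d : ℕ} {F : ConfocalSystem K d} {G : Set (PLine K d)}
  {m M : ℕ} {Q : Fin M → QMat K d} {e : Fin m → Fin M}

theorem ConfocalSystem.IsRegularDomain.comp (H : F.IsRegularDomain Q G)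
    (he : Function.Injective e) : F.IsRegularDomain (Q ∘ e) G where
  two_ne_zero := H.two_ne_zero
  isMember j := H.isMember (e j)
  distinct i j hij := H.distinct (e i) (e j) (he.ne hij)
  regular ℓ hℓ j u hu := H.regular ℓ hℓ (e j) u hu
  closed ℓ hℓ j u Q' hu hQ' hc := H.closed ℓ hℓ (e j) u Q' hu hQ' hc

/-- Forget the marked points on some of the quadrics. -/
def MarkedLine.restrict (s : MarkedLine Q G) (e : Fin m → Fin M) : MarkedLine (Q ∘ e) G where
  line := s.line
  line_mem := s.line_mem
  mark j := s.mark (e j)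
  marked j := s.marked (e j)

/-- The new mark on `Q k` depends only on the line and the marks on `Q j` and `Q k`, so other marks
may be forgotten before or after the step. -/
theorem ConfocalSystem.IsRegularDomain.restrict_billiard (H : F.IsRegularDomain Q G)
    (he : Function.Injective e) (j : Fin m) (s : MarkedLine Q G) :
    (H.billiard (e j) s).restrict e = (H.comp he).billiard j (s.restrict e) := by
  refine MarkedLine.ext rfl (funext fun k => ?_)
  by_cases h : k = j
  · subst h
    rw [(H.comp he).billiard_mark_self]
    exact H.billiard_mark_self (e k) s
  · rw [(H.comp he).billiard_mark_ne h]
    exact H.billiard_mark_ne (he.ne h) s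

end Restriction

/-! ### Coordinates of the extended lattice. -/

section Snoc

variable {K : Type*} {d m : ℕ}

theorem latticeSnoc_add_unitVec (n : Fin m → ℤ) (k : ℤ) (j : Fin m) :
    latticeSnoc (n + unitVec j) k = latticeSnoc n k + unitVec j.castSucc := by
  funext i
  refine Fin.lastCases ?_ (fun i => ?_) i
  · simp [latticeSnoc, unitVec, Fin.ext_iff, j.isLt.ne']
  · simp [latticeSnoc, unitVec, Pi.single_apply]

theorem latticeSnoc_add_last (n : Fin m → ℤ) (k : ℤ) :
    latticeSnoc n (k + 1) = latticeSnoc n k + unitVec (Fin.last m) := by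
  funext i
  refine Fin.lastCases ?_ (fun i => ?_) i
  · simp [latticeSnoc, unitVec]
  · simp [latticeSnoc, unitVec, Fin.ext_iff, i.isLt.ne]

theorem quadricSnoc_comp_castSucc (Q : Fin m → QMat K d) (Qδ : QMat K d) :
    quadricSnoc Q Qδ ∘ Fin.castSucc = Q := by
  funext i
  simp [quadricSnoc]

theorem quadricSnoc_castSucc (Q : Fin m → QMat K d) (Qδ : QMat K d) (j : Fin m) :
    quadricSnoc Q Qδ j.castSucc = Q j := congrFun (quadricSnoc_comp_castSucc Q Qδ) j

theorem quadricSnoc_last (Q : Fin m → QMat K d) (Qδ : QMat K d) :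
    quadricSnoc Q Qδ (Fin.last m) = Qδ := by
  simp [quadricSnoc]

end Snoc

/-! ### Existence and uniqueness of the extension; the F-transformation. -/

section Extension

variable {K : Type*} [Field K] {d m : ℕ}

theorem ConfocalSystem.Reflects.linesMeet {F : ConfocalSystem K d} {Q : QMat K d}
    (hQ : F.IsMember Q) {x : HVec K d} {ℓ ℓ' : PLine K d} (h : F.Reflects Q x ℓ ℓ') :
    LinesMeet ℓ ℓ' := by
  have h₁ := (h.marked hQ).1
  have h₂ := (h.symm.marked hQ).1
  exact ⟨_, fun h0 => h₁.1 (hQ.inv_mulVec_injective (by rw [h0, Matrix.mulVec_zero])), h₁.2.2.1,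
    h₂.2.2.1⟩

theorem ConfocalSystem.IsDoubleReflectionNet.exists_reflects {F : ConfocalSystem K d}
    {C : Fin (d - 1) → QMat K d} {Q : Fin m → QMat K d} {φ : (Fin m → ℤ) → PLine K d}
    (h : F.IsDoubleReflectionNet C Q φ) (n : Fin m → ℤ) (j : Fin m) :
    ∃ x, F.Reflects (Q j) x (φ n) (φ (n + unitVec j)) := by
  obtain ⟨-, -, P, hP, -⟩ := h
  have := (hP j n 0).1
  exact ⟨P j n, by simpa using this⟩

theorem ConfocalSystem.IsDoubleReflectionNet.isLineCongruence {F : ConfocalSystem K d}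
    {C : Fin (d - 1) → QMat K d} {Q : Fin m → QMat K d} {φ : (Fin m → ℤ) → PLine K d}
    (h : F.IsDoubleReflectionNet C Q φ) : IsLineCongruence φ := fun n j => by
  obtain ⟨x, hx⟩ := h.exists_reflects n j
  exact hx.linesMeet (h.1 j)

theorem ConfocalSystem.IsNetExtension.isFTransformation {F : ConfocalSystem K d}
    {C : Fin (d - 1) → QMat K d} {Q : Fin m → QMat K d} {φ : (Fin m → ℤ) → PLine K d}
    (hφ : F.IsDoubleReflectionNet C Q φ) {Qδ : QMat K d} {n₀ : Fin m → ℤ} {ℓ' : PLine K d}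
    {φ' : (Fin (m + 1) → ℤ) → PLine K d} (h : F.IsNetExtension C Q Qδ φ n₀ ℓ' φ') :
    IsFTransformation φ fun n => φ' (latticeSnoc n 1) := by
  obtain ⟨hnet, h0, -⟩ := h
  have hc := hnet.isLineCongruence
  refine ⟨hφ.isLineCongruence, fun n j => ?_, fun n => ?_⟩
  · beta_reduce
    rw [latticeSnoc_add_unitVec]
    exact hc _ _
  · have := hc (latticeSnoc n 0) (Fin.last m)
    rwa [← latticeSnoc_add_last, h0, zero_add] at this

theorem ConfocalSystem.RegularOrbit.isRegularDomain (h2 : (2 : K) ≠ 0) (hd : 2 ≤ d)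
    {F : ConfocalSystem K d} {Q : Fin m → QMat K d} (hQ : ∀ j, F.IsMember (Q j))
    (hne : ∀ i j, i ≠ j → ¬ SameQuadric (Q i) (Q j)) {ℓ₀ : PLine K d}
    (h : F.RegularOrbit Q ℓ₀) : F.IsRegularDomain Q {ℓ | F.Reachable Q ℓ₀ ℓ} where
  two_ne_zero := h2
  isMember := hQ
  distinct := hne
  regular ℓ hℓ j u hu := by
    have hx : (Q j).mulVec ((Q j)⁻¹.mulVec u) = u := (hQ j).mulVec_inv_mulVec u
    obtain ⟨Q₂, z, hQ₂, hz, hzu⟩ := h ℓ hℓ j ((Q j)⁻¹.mulVec u) hu.2.2.1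
      ⟨fun h0 => hu.1 (by rw [← hx, h0, Matrix.mulVec_zero]), by
        rw [hx, dotProduct_comm]
        exact hu.2.1⟩
    refine ⟨Q₂, hQ₂, fun h0 => hzu ?_⟩
    unfold IsPoleOfTangent at hz
    rw [hx] at hz
    rw [mem_polarHyperplane, hx, ← hQ₂.inv_mulVec_mulVec z, hz]
    exact h0
  closed ℓ hℓ j u Q' hu hQ' hc :=
    Reachable.step j _ ℓ _ hℓ (reflects_of_marked hd (hQ j) hQ' hu hc)

theorem ConfocalSystem.existsUnique_netExtension (h2 : (2 : K) ≠ 0) (hd : 2 ≤ d)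
    (F : ConfocalSystem K d) {C : Fin (d - 1) → QMat K d} (hC : ∀ a, F.IsMember (C a))
    {Q : Fin m → QMat K d} {φ : (Fin m → ℤ) → PLine K d} (hφ : F.IsDoubleReflectionNet C Q φ)
    {Qδ : QMat K d} (hQδ : F.IsMember Qδ) {n₀ : Fin m → ℤ} {ℓ' : PLine K d}
    (hℓ' : ∃ x, F.Reflects Qδ x (φ n₀) ℓ')
    (hne : ∀ i j, i ≠ j → ¬ SameQuadric (quadricSnoc Q Qδ i) (quadricSnoc Q Qδ j))
    (hreg : F.RegularOrbit (quadricSnoc Q Qδ) (φ n₀)) :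
    ∃! φ' : (Fin (m + 1) → ℤ) → PLine K d, F.IsNetExtension C Q Qδ φ n₀ ℓ' φ' := by
  have hQ' : ∀ j, F.IsMember (quadricSnoc Q Qδ j) := fun j => by
    refine Fin.lastCases ?_ (fun j => ?_) j
    · rwa [quadricSnoc_last]
    · rw [quadricSnoc_castSucc]
      exact hφ.1 j
  have H := hreg.isRegularDomain h2 hd hQ' hne
  -- The prescribed neighbours of `φ n₀` in all `m + 1` directions, with `ℓ'` in the last one.
  have hx : ∀ j, ∃ x, F.Reflects (quadricSnoc Q Qδ j) x (φ n₀)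
      (Fin.snoc (α := fun _ => PLine K d) (fun j => φ (n₀ + unitVec j)) ℓ' j) := fun j => by
    refine Fin.lastCases ?_ (fun j => ?_) j
    · rwa [quadricSnoc_last, Fin.snoc_last]
    · rw [quadricSnoc_castSucc, Fin.snoc_castSucc]
      exact hφ.exists_reflects n₀ j
  choose x hx using hx
  have hm := fun j => ((hx j).marked (hQ' j)).1
  let s : MarkedLine (quadricSnoc Q Qδ) {ℓ | F.Reachable (quadricSnoc Q Qδ) (φ n₀) ℓ} :=
    { line := φ n₀
      line_mem := Reachable.start
      mark := fun j => Projectivization.mk K _ (hm j).1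
      marked := fun j => (marked_rep_mk _).2 (hm j) }
  have hs : ∀ j, (H.billiard j s).line =
      Fin.snoc (α := fun _ => PLine K d) (fun j => φ (n₀ + unitVec j)) ℓ' j := fun j =>
    H.reflect_of_reflects (hx j) _
  set N₀ := latticeSnoc n₀ 0
  -- On the sublattice at height `0`, forgetting the mark on `Qδ` turns the large orbit into an
  -- orbit for `Q`, and `φ` is the orbit of the same marked line.
  have hφ_act : ∀ n, φ n = (H.act (latticeSnoc n 0 - N₀) s).line := by
    have he := Fin.castSucc_injective m
    have hφ' := hφ
    rw [← quadricSnoc_comp_castSucc Q Qδ] at hφ'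
    intro n
    have h₁ := hφ'.eq_act hd (H.comp he) (n₀ := n₀) (s.restrict Fin.castSucc) rfl (fun j => by
      have h := H.reflects_billiard hd j.castSucc s
      rw [hs, Fin.snoc_castSucc] at h
      exact h) n
    have h₂ := (H.comp he).eq_act
      (f := fun n => (H.act (latticeSnoc n 0 - N₀) s).restrict Fin.castSucc) (fun n j => by
        rw [latticeSnoc_add_unitVec, add_sub_right_comm, H.act_add_unitVec,
          H.restrict_billiard he]) n n₀
    have h₃ : H.act (latticeSnoc n₀ 0 - N₀) s = s := by
      rw [sub_self, H.act_zero]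
    simp only [h₃] at h₂
    rw [h₁, ← h₂]
    rfl
  refine ⟨fun N => (H.act (N - N₀) s).line, ⟨?_, ?_, ?_⟩, ?_⟩
  · exact H.isDoubleReflectionNet_act hd hC s (hφ.2.1 n₀) N₀
  · exact fun n => (hφ_act n).symm
  · have e : latticeSnoc n₀ 1 - N₀ = 0 + unitVec (Fin.last m) := by
      rw [zero_add, sub_eq_iff_eq_add', ← latticeSnoc_add_last, zero_add]
    change (H.act (latticeSnoc n₀ 1 - N₀) s).line = ℓ'
    rw [e, H.act_add_unitVec, H.act_zero, hs, Fin.snoc_last]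
  · rintro ψ ⟨hψ, hψ₀, hψ₁⟩
    funext N
    refine hψ.eq_act hd H s (hψ₀ n₀).symm (fun j => ?_) N
    have h := H.reflects_billiard hd j s
    rw [hs] at h
    rw [hψ₀]
    convert h using 1
    refine Fin.lastCases ?_ (fun j => ?_) j
    · rw [← latticeSnoc_add_last, zero_add, hψ₁, Fin.snoc_last]
    · rw [← latticeSnoc_add_unitVec, hψ₀, Fin.snoc_castSucc]

end Extension

theorem mainTheorem10 {K : Type*} [Field K] (h2 : (2 : K) ≠ 0) {d m : ℕ} (hd : 2 ≤ d)
    (F : ConfocalSystem K d)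
    (C : Fin (d - 1) → QMat K d) (hC : ∀ a, F.IsMember (C a))
    (Q : Fin m → QMat K d) (φ : (Fin m → ℤ) → PLine K d)
    (hφ : F.IsDoubleReflectionNet C Q φ)
    (Qδ : QMat K d) (hQδ : F.IsMember Qδ)
    (n₀ : Fin m → ℤ) (ℓ' : PLine K d) (hℓ' : ∃ x, F.Reflects Qδ x (φ n₀) ℓ') :
    ((∀ i j, i ≠ j → ¬ SameQuadric (quadricSnoc Q Qδ i) (quadricSnoc Q Qδ j)) →
      F.RegularOrbit (quadricSnoc Q Qδ) (φ n₀) →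
      ∃! φ' : (Fin (m + 1) → ℤ) → PLine K d, F.IsNetExtension C Q Qδ φ n₀ ℓ' φ') ∧
    (∀ φ' : (Fin (m + 1) → ℤ) → PLine K d, F.IsNetExtension C Q Qδ φ n₀ ℓ' φ' →
      IsFTransformation φ (fun n => φ' (latticeSnoc n 1))) :=
  ⟨fun hne hreg => F.existsUnique_netExtension h2 hd hC hφ hQδ hℓ' hne hreg,
    fun _ h => h.isFTransformation hφ⟩
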